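/- Let $d\ge 1$, $n\ge 1$, and let $l=(l_1,\dots,l_d)$, $u=(u_1,\dots,u_d)$ be fixed vectors of positive integers with $l_1>l_2>\cdots>l_d\ge 1$, $l_1<u_1$ and $\sum_{i=1}^d u_i\le n$. For a sample $x=(x_1,\dots,x_n)\in(\mathbb R^d)^n$ define its *iterative segmentation* symbol $(s_{l},s_{u},n)$, $s_l=(s_{l,1},\dots,s_{l,d})$, $s_u=(s_{u,1},\dots,s_{u,d})$, recursively in $i=1,\dots,d$: $s_{l,i}$ is the $l_i$-th order statistic (counted from the smallest) of the $i$-th coordinates of those sample points whose $j$-th coordinate is $<s_{l,j}$ for all $j<i$, and $s_{u,i}$ is the $u_i$-th order statistic (counted from the smallest) of the $i$-th coordinates of those sample points whose $j$-th coordinate is $>s_{u,j}$ for all $j<i$. Let $\boldsymbol X=(X^{(1)},\dots,X^{(n)})$ be a random sample with joint density $g_{\boldsymbol X}(x;\theta)=\prod_{k=1}^n g_X(x_k;\theta)$, where $g_X(\cdot\,;\theta)$, $\theta\in\Theta$, are probability densities on $\mathbb R^d$, and let $S=(S_l,S_u,N)$, with $N=n$, be the iterative segmentation symbol of $\boldsymbol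 X$. Then for every $\theta$ the symbol $S$ has a density $L(s;\theta)$, $s=(s_l,s_u,N)$, with respect to Lebesgue measure on $\mathbb R^d\times\mathbb R^d$ times counting measure on $\mathbb N$ (the symbolic likelihood function). It vanishes almost everywhere off $\{s_{l,1}<s_{u,1},\ N=n\}$, and there is a constant $C>0$, depending only on $n,d,l,u$, such that for almost every $s$ with $s_{l,1}<s_{u,1}$ and $N=n$ $$ L(s;\theta)= C\;\mathbb P(s_{l,1}<X_1<s_{u,1})^{u_1-l_1-1}\; g_{X_1}(s_{l,1})\,g_{X_1}(s_{u,1})\;\prod_{i=2}^{d+1}p_i(s_l)\,q_i(s_u), $$ where $X=(X_1,\dots,X_d)$ has density $g_X(\cdot\,;\theta)$, $g_{X_i}$ is the density of the $i$-th margin $X_i$, $0^0=1$, $$ p_{d+1}(s_l)=\mathbb P(X_1<s_{l,1},\dots,X_d<s_{l,d})^{l_d-1},\qquad q_{d+1}(s_u)=\mathbb P(X_1>s_{u,1},\dots,X_d>s_{u,d})^{\,n-\sum_{i=1}^d u_i}, $$ and for $i=2,\dots,d$ $$ p_i(s_l)=\mathbb P(X_j<s_{l,j};\,j<i\mid X_i=s_{l,i})\;g_{X_i}(s_{l,i})\;\bigl[\mathbb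 P(X_j<s_{l,j};\,j<i)-\mathbb P(X_j<s_{l,j};\,j\le i)\bigr]^{\,l_{i-1}-l_i-1}, $$ $$ q_i(s_u)=\mathbb P(X_j>s_{u,j};\,j<i\mid X_i=s_{u,i})\;g_{X_i}(s_{u,i})\;\bigl[\mathbb P(X_j>s_{u,j};\,j<i)-\mathbb P(X_j>s_{u,j};\,j\le i)\bigr]^{\,u_i-1}. $$ -/

import Mathlib

open MeasureTheory ProbabilityTheory
open scoped ENNReal NNReal

noncomputable section

/-- The `r`-th order statistic (`r = 1` is the minimum) of the values `v k`, `k ∈ A`: the smallest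
real `t` such that at least `r` of these values are `≤ t`. It is meaningful for
`1 ≤ r ≤ A.ncard`. -/
def orderStat {n : ℕ} (A : Set (Fin n)) (v : Fin n → ℝ) (r : ℕ) : ℝ :=
  sInf {t : ℝ | r ≤ {k | k ∈ A ∧ v k ≤ t}.ncard}

/-- The lower end points: `segLower l x i` is the `l i`-th order statistic of the `i`-th coordinates
of those points of the sample `x` that lie strictly below all earlier lower end points. -/
def segLower {n D : ℕ} (l : Fin D → ℕ) (x : Fin n → Fin D → ℝ) (i : Fin D) : ℝ :=
  orderStat {k | ∀ j, (_h : j < i) → x k j < segLower l x j} (fun k => x k i) (l i)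
termination_by i
decreasing_by exact _h

/-- The upper end points: `segUpper u x i` is the `u i`-th order statistic of the `i`-th coordinates
of those points of the sample `x` that lie strictly above all earlier upper end points. -/
def segUpper {n D : ℕ} (u : Fin D → ℕ) (x : Fin n → Fin D → ℝ) (i : Fin D) : ℝ :=
  orderStat {k | ∀ j, (_h : j < i) → segUpper u x j < x k j} (fun k => x k i) (u i)
termination_by i
decreasing_by exact _h

/-- Rectangle-valued symbols `(s_l, s_u, N)` in dimension `D`: lower end points, upper end points,
number of underlying points. -/
abbrev RectSymbol (D : ℕ) : Type := (Fin D → ℝ) × (Fin D → ℝ) × ℕ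

/-- The reference measure on symbols: Lebesgue measure in the end points, counting measure in the
number of points. -/
def symbolMeasure (D : ℕ) : Measure (RectSymbol D) :=
  (volume : Measure (Fin D → ℝ)).prod ((volume : Measure (Fin D → ℝ)).prod Measure.count)

/-- The aggregation function of iterative segmentation. -/
def iterSeg {n D : ℕ} (l u : Fin D → ℕ) (x : Fin n → Fin D → ℝ) : RectSymbol D :=
  (segLower l x, segUpper u x, n)

/-- The law on `ℝ^D` with Lebesgue density `f`. -/
def pointLaw {D : ℕ} (f : (Fin D → ℝ) → ℝ) : Measure (Fin D → ℝ) :=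
  volume.withDensity fun x => ENNReal.ofReal (f x)

/-- `d ℙ(X_i < t)`: the Lebesgue density at `t` of the `i`-th margin of `X ∼ μ`. -/
def marginDensity {D : ℕ} (μ : Measure (Fin D → ℝ)) (i : Fin D) (t : ℝ) : ℝ≥0∞ :=
  pdf (fun x : Fin D → ℝ => x i) μ volume t

/-- `ℙ(X ∈ A | X_i = t)` for `X ∼ μ`. -/
def condProbAt {D : ℕ} (μ : Measure (Fin D → ℝ)) [IsFiniteMeasure μ] (i : Fin D) (t : ℝ)
    (A : Set (Fin D → ℝ)) : ℝ≥0∞ :=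
  condDistrib (fun x : Fin D → ℝ => x) (fun x : Fin D → ℝ => x i) μ t A

/-- The factor `p_i` for the coordinate `i = k.succ`, whose predecessor is `k.castSucc`. -/
def segP {m : ℕ} (μ : Measure (Fin (m + 1) → ℝ)) [IsFiniteMeasure μ] (l : Fin (m + 1) → ℕ)
    (a : Fin (m + 1) → ℝ) (k : Fin m) : ℝ≥0∞ :=
  condProbAt μ k.succ (a k.succ) {x | ∀ j < k.succ, x j < a j}
    * marginDensity μ k.succ (a k.succ)
    * (μ {x | ∀ j < k.succ, x j < a j} - μ {x | ∀ j ≤ k.succ, x j < a j})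
        ^ (l k.castSucc - l k.succ - 1)

/-- The factor `q_i` for the coordinate `i = k.succ`. -/
def segQ {m : ℕ} (μ : Measure (Fin (m + 1) → ℝ)) [IsFiniteMeasure μ] (u : Fin (m + 1) → ℕ)
    (b : Fin (m + 1) → ℝ) (k : Fin m) : ℝ≥0∞ :=
  condProbAt μ k.succ (b k.succ) {x | ∀ j < k.succ, b j < x j}
    * marginDensity μ k.succ (b k.succ)
    * (μ {x | ∀ j < k.succ, b j < x j} - μ {x | ∀ j ≤ k.succ, b j < x j}) ^ (u k.succ - 1)

/-- The closing factor `p_{d+1}`. -/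
def segPLast {m : ℕ} (μ : Measure (Fin (m + 1) → ℝ)) (l : Fin (m + 1) → ℕ)
    (a : Fin (m + 1) → ℝ) : ℝ≥0∞ :=
  μ {x | ∀ j, x j < a j} ^ (l (Fin.last m) - 1)

/-- The closing factor `q_{d+1}`, for `N` points. -/
def segQLast {m : ℕ} (μ : Measure (Fin (m + 1) → ℝ)) (u : Fin (m + 1) → ℕ) (N : ℕ)
    (b : Fin (m + 1) → ℝ) : ℝ≥0∞ :=
  μ {x | ∀ j, b j < x j} ^ (N - ∑ i, u i)

/-- The product formula for iterative segmentation, at the symbol `s = (s_l, s_u, N)`, when the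
points have law `μ` on `ℝ^(m+1)`. -/
def iterSegProduct {m : ℕ} (μ : Measure (Fin (m + 1) → ℝ)) [IsFiniteMeasure μ]
    (l u : Fin (m + 1) → ℕ) (s : RectSymbol (m + 1)) : ℝ≥0∞ :=
  μ {x | s.1 0 < x 0 ∧ x 0 < s.2.1 0} ^ (u 0 - l 0 - 1)
    * marginDensity μ 0 (s.1 0) * marginDensity μ 0 (s.2.1 0)
    * (∏ k : Fin m, segP μ l s.1 k * segQ μ u s.2.1 k)
    * (segPLast μ l s.1 * segQLast μ u s.2.2 s.2.1)

end

/-! The proof is a multinomial count. Given end points with first lower below first upper, space is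
the disjoint union of regions: one hyperplane piece per end point, plus open cells
(`existsUnique_segRegion`). For a sample without ties, each end-point piece holds exactly one sample
point and each cell holds a number fixed by `n`, `l`, `u`. So almost every sample lies in the event
of an assignment of sample points to regions with these counts (`exists_mem_event`). Conversely, on
such an event the counts force the end points read off from the assigned points to be the
segmentation symbol (`SegAssignment.endPoints_eq`), so different events are disjoint.

On one event, Tonelli integrates out the points in the cells, giving powers of cell probabilities.
It then integrates out all but one coordinate of each end-point observation, giving masses of slices
of the density (`SegAssignment.setLIntegral_event`). The result does not depend on the assignment,
so summing over the events multiplies it by their number, which is `C`.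

Finally, a slice mass is a conditional probability times a marginal density
(`condProbAt_mul_marginDensity_ae`), and the cell probabilities are differences of orthant
probabilities because hyperplanes are null. -/

/-! ### Tonelli for products over sample points and for split coordinates. -/

theorem lintegral_fin_prod_eq_prod {n : ℕ} {α : Type*} [MeasurableSpace α]
    (μ : Measure α) [SigmaFinite μ] (f : Fin n → α → ℝ≥0∞) (hf : ∀ i, Measurable (f i)) :
    ∫⁻ x : Fin n → α, ∏ i, f i (x i) ∂Measure.pi (fun _ => μ) = ∏ i, ∫⁻ x, f i x ∂μ := by
  induction n with
  | zero => simp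
  | succ n ih =>
    have hm : Measurable fun x : Fin (n + 1) → α => ∏ i, f i (x i) :=
      Finset.measurable_prod _ fun i _ => (hf i).comp (measurable_pi_apply i)
    rw [← ((measurePreserving_piFinSuccAbove (fun _ : Fin (n + 1) => μ) 0).symm).lintegral_comp hm,
      Fin.prod_univ_succ, ← ih (fun i => f i.succ) fun i => hf i.succ,
      ← lintegral_prod_mul (hf 0).aemeasurable (Finset.measurable_prod _ fun i _ =>
        (hf i.succ).comp (measurable_pi_apply i)).aemeasurable]
    refine lintegral_congr fun x => ?_
    rw [Fin.prod_univ_succ]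
    rfl

theorem lintegral_fintype_prod_eq_prod {ι : Type*} [Fintype ι] {α : Type*} [MeasurableSpace α]
    (μ : Measure α) [SigmaFinite μ] (f : ι → α → ℝ≥0∞) (hf : ∀ i, Measurable (f i)) :
    ∫⁻ x : ι → α, ∏ i, f i (x i) ∂Measure.pi (fun _ => μ) = ∏ i, ∫⁻ x, f i x ∂μ := by
  let e := (Fintype.equivFin ι).symm
  have hm : Measurable fun x : ι → α => ∏ i, f i (x i) :=
    Finset.measurable_prod _ fun i _ => (hf i).comp (measurable_pi_apply i)
  have h := measurePreserving_piCongrLeft (fun _ : ι => μ) e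
  rw [← h.lintegral_comp hm, ← e.prod_comp,
    ← lintegral_fin_prod_eq_prod μ (fun i => f (e i)) fun i => hf (e i)]
  refine lintegral_congr fun x => ?_
  rw [← e.prod_comp]
  simp [MeasurableEquiv.coe_piCongrLeft, Equiv.piCongrLeft_apply_apply]

/-- Integrating out the coordinates outside the range of `P`, when the integrand is a product over
these coordinates with parameters in the remaining ones. -/
theorem lintegral_prod_sum_reindex {ι P R α : Type*} [Fintype ι] [Fintype P] [Fintype R]
    [MeasureSpace α] [SigmaFinite (volume : Measure α)] (e : P ⊕ R ≃ ι)
    (φ : (P → α) → ℝ≥0∞) (hφ : Measurable φ) (h : R → (P → α) → α → ℝ≥0∞)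
    (hh : ∀ r, Measurable (Function.uncurry (h r))) :
    ∫⁻ x : ι → α, φ (fun p => x (e (.inl p))) *
        ∏ r, h r (fun p => x (e (.inl p))) (x (e (.inr r))) =
      ∫⁻ y : P → α, φ y * ∏ r, ∫⁻ z, h r y z := by
  have hm : Measurable fun x : ι → α => φ (fun p => x (e (.inl p))) *
        ∏ r, h r (fun p => x (e (.inl p))) (x (e (.inr r))) := by
    refine (hφ.comp (by fun_prop)).mul (Finset.measurable_prod _ fun r _ => ?_)
    exact (hh r).comp (f := fun x : ι → α => ((fun p => x (e (.inl p))), x (e (.inr r))))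
      (by fun_prop)
  have hp := (volume_measurePreserving_piCongrLeft (fun _ : ι => α) e).comp
    (volume_measurePreserving_sumPiEquivProdPi_symm (fun _ : P ⊕ R => α))
  rw [← hp.lintegral_comp hm]
  have key : ∀ yz : (P → α) × (R → α), ∀ s : P ⊕ R,
      (MeasurableEquiv.piCongrLeft (fun _ : ι => α) e)
        ((MeasurableEquiv.sumPiEquivProdPi (fun _ : P ⊕ R => α)).symm yz) (e s)
        = Sum.elim yz.1 yz.2 s := by
    intro yz s
    rw [MeasurableEquiv.coe_piCongrLeft, Equiv.piCongrLeft_apply_apply]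
    cases s <;> rfl
  simp only [Function.comp_apply, key, Sum.elim_inl, Sum.elim_inr]
  have hm' : Measurable fun yz : (P → α) × (R → α) => φ (fun p => yz.1 p) *
      ∏ r, h r (fun p => yz.1 p) (yz.2 r) := by
    refine (hφ.comp (by fun_prop)).mul (Finset.measurable_prod _ fun r _ => ?_)
    exact (hh r).comp (f := fun yz : (P → α) × (R → α) => (yz.1, yz.2 r)) (by fun_prop)
  rw [Measure.volume_eq_prod, lintegral_prod _ hm'.aemeasurable]
  refine lintegral_congr fun y => ?_
  dsimp only
  have hr : ∀ r, Measurable (h r y) := fun r => (hh r).comp measurable_prodMk_left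
  have hz : Measurable fun z : R → α => ∏ r, h r y (z r) :=
    Finset.measurable_prod _ fun r _ => (hr r).comp (measurable_pi_apply r)
  rw [lintegral_const_mul _ hz, volume_pi,
    ← lintegral_fintype_prod_eq_prod volume (fun r => h r y) hr]

theorem measurable_insertNth {m : ℕ} (i : Fin (m + 1)) :
    Measurable fun tz : ℝ × (Fin m → ℝ) => i.insertNth (α := fun _ => ℝ) tz.1 tz.2 :=
  (MeasurableEquiv.piFinSuccAbove (fun _ : Fin (m + 1) => ℝ) i).symm.measurable

/-- Splitting one coordinate off each of finitely many points. -/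
theorem lintegral_pi_insertNth {P : Type*} [Fintype P] {m : ℕ} (coord : P → Fin (m + 1))
    (Φ : (P → ℝ) → ℝ≥0∞) (hΦ : Measurable Φ) (h : P → (P → ℝ) → (Fin (m + 1) → ℝ) → ℝ≥0∞)
    (hh : ∀ p, Measurable (Function.uncurry (h p))) :
    ∫⁻ y : P → Fin (m + 1) → ℝ, Φ (fun p => y p (coord p)) *
        ∏ p, h p (fun p => y p (coord p)) (y p) =
      ∫⁻ t : P → ℝ, Φ t *
        ∏ p, ∫⁻ z : Fin m → ℝ, h p t ((coord p).insertNth (α := fun _ => ℝ) (t p) z) := by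
  have hm : Measurable fun y : P → Fin (m + 1) → ℝ => Φ (fun p => y p (coord p)) *
        ∏ p, h p (fun p => y p (coord p)) (y p) := by
    refine (hΦ.comp (by fun_prop)).mul (Finset.measurable_prod _ fun r _ => ?_)
    exact (hh r).comp (f := fun y : P → Fin (m + 1) → ℝ => ((fun p => y p (coord p)), y r))
      (by fun_prop)
  have hp := (volume_preserving_pi fun p : P =>
      (volume_preserving_piFinSuccAbove (fun _ : Fin (m + 1) => ℝ) (coord p)).symm).comp
    (volume_measurePreserving_arrowProdEquivProdArrow ℝ (Fin m → ℝ) P).symm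
  rw [← hp.lintegral_comp hm]
  have key : ∀ (tz : (P → ℝ) × (P → Fin m → ℝ)) (p : P),
      (MeasurableEquiv.piFinSuccAbove (fun _ : Fin (m + 1) => ℝ) (coord p)).symm
        ((MeasurableEquiv.arrowProdEquivProdArrow ℝ (Fin m → ℝ) P).symm tz p)
        = (coord p).insertNth (α := fun _ => ℝ) (tz.1 p) (tz.2 p) := by
    intro tz p
    rfl
  simp only [Function.comp_apply, key, Fin.insertNth_apply_same]
  have hi : ∀ p, Measurable fun q : (P → ℝ) × (Fin m → ℝ) =>
      h p q.1 ((coord p).insertNth (α := fun _ => ℝ) (q.1 p) q.2) := fun p =>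
    (hh p).comp (measurable_fst.prodMk ((measurable_insertNth (coord p)).comp
      (((measurable_pi_apply p).comp measurable_fst).prodMk measurable_snd)))
  have hm' : Measurable fun tz : (P → ℝ) × (P → Fin m → ℝ) => Φ (fun p => tz.1 p) *
      ∏ p, h p (fun p => tz.1 p) ((coord p).insertNth (α := fun _ => ℝ) (tz.1 p) (tz.2 p)) := by
    refine (hΦ.comp (by fun_prop)).mul (Finset.measurable_prod _ fun p _ => ?_)
    exact (hi p).comp (f := fun tz : (P → ℝ) × (P → Fin m → ℝ) => (tz.1, tz.2 p)) (by fun_prop)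
  rw [Measure.volume_eq_prod, lintegral_prod _ hm'.aemeasurable]
  refine lintegral_congr fun t => ?_
  dsimp only
  have hr : ∀ p, Measurable fun z =>
      h p t ((coord p).insertNth (α := fun _ => ℝ) (t p) z) :=
    fun p => (hi p).comp measurable_prodMk_left
  have hz : Measurable fun z : P → Fin m → ℝ =>
      ∏ p, h p t ((coord p).insertNth (α := fun _ => ℝ) (t p) (z p)) :=
    Finset.measurable_prod _ fun p _ => (hr p).comp (measurable_pi_apply p)
  rw [lintegral_const_mul _ hz, volume_pi (α := fun _ : P => Fin m → ℝ),
    ← lintegral_fintype_prod_eq_prod volume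
      (fun p z => h p t ((coord p).insertNth (α := fun _ => ℝ) (t p) z)) hr]

/-! ### Slices of a density, margins and conditional laws. -/

/-- The mass that the Lebesgue density `f` puts on the slice `{x ∈ A | x i = t}`. -/
noncomputable def sliceMass {m : ℕ} (f : (Fin (m + 1) → ℝ) → ℝ) (i : Fin (m + 1)) (t : ℝ)
    (A : Set (Fin (m + 1) → ℝ)) : ℝ≥0∞ :=
  ∫⁻ z : Fin m → ℝ, A.indicator (fun x => ENNReal.ofReal (f x))
    (i.insertNth (α := fun _ => ℝ) t z)

section slice

variable {m : ℕ} {f : (Fin (m + 1) → ℝ) → ℝ} (hf : Measurable f) (i : Fin (m + 1))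
include hf

theorem measurable_indicator_insertNth {A : Set (Fin (m + 1) → ℝ)} (hA : MeasurableSet A) :
    Measurable fun tz : ℝ × (Fin m → ℝ) => A.indicator (fun x => ENNReal.ofReal (f x))
      (i.insertNth (α := fun _ => ℝ) tz.1 tz.2) :=
  ((hf.ennreal_ofReal).indicator hA).comp (measurable_insertNth i)

theorem measurable_sliceMass {A : Set (Fin (m + 1) → ℝ)} (hA : MeasurableSet A) :
    Measurable fun t => sliceMass f i t A :=
  (measurable_indicator_insertNth hf i hA).lintegral_prod_right'

/-- Tonelli with coordinate `i` split off. This disintegration yields the marginal density (`A` the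
whole space) and the conditional law. -/
theorem setLIntegral_sliceMass {B : Set ℝ} (hB : MeasurableSet B)
    {A : Set (Fin (m + 1) → ℝ)} (hA : MeasurableSet A) :
    ∫⁻ t in B, sliceMass f i t A = pointLaw f ({x | x i ∈ B} ∩ A) := by
  have key : ∀ t z, (MeasurableEquiv.piFinSuccAbove (fun _ : Fin (m + 1) => ℝ) i).symm (t, z) =
      i.insertNth (α := fun _ => ℝ) t z := fun _ _ => rfl
  have hS : MeasurableSet ({x : Fin (m + 1) → ℝ | x i ∈ B} ∩ A) :=
    (measurable_pi_apply i hB).inter hA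
  rw [pointLaw, withDensity_apply _ hS, ← lintegral_indicator hS,
    ← (volume_preserving_piFinSuccAbove (fun _ : Fin (m + 1) => ℝ) i).symm.lintegral_comp
      ((hf.ennreal_ofReal).indicator hS),
    Measure.volume_eq_prod, lintegral_prod, ← lintegral_indicator hB]
  · refine lintegral_congr fun t => ?_
    by_cases ht : t ∈ B
    · simp only [Set.indicator_of_mem ht, sliceMass]
      refine lintegral_congr fun z => ?_
      have hx : ∀ x : Fin (m + 1) → ℝ, x i ∈ B →
          A.indicator (fun x => ENNReal.ofReal (f x)) x =
            ({x | x i ∈ B} ∩ A).indicator (fun x => ENNReal.ofReal (f x)) x := by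
        intro x hx
        by_cases h : x ∈ A
        · rw [Set.indicator_of_mem h, Set.indicator_of_mem (Set.mem_inter (show x ∈ {x | x i ∈ B} from hx) h)]
        · rw [Set.indicator_of_notMem h, Set.indicator_of_notMem fun h' => h h'.2]
      exact hx _ (by simpa using ht)
    · have hx : ∀ z, i.insertNth (α := fun _ => ℝ) t z ∉ {x : Fin (m + 1) → ℝ | x i ∈ B} := by
        simpa using ht
      simp [key, Set.indicator, hx, ht]
  · exact (((hf.ennreal_ofReal).indicator hS).comp (measurable_insertNth i)).aemeasurable

theorem map_eval_pointLaw :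
    (pointLaw f).map (fun x => x i) = volume.withDensity fun t => sliceMass f i t Set.univ := by
  ext B hB
  rw [Measure.map_apply (measurable_pi_apply i) hB, withDensity_apply _ hB,
    setLIntegral_sliceMass hf i hB .univ, Set.inter_univ]
  rfl

theorem marginDensity_ae :
    marginDensity (pointLaw f) i =ᵐ[volume] fun t => sliceMass f i t Set.univ := by
  have h : marginDensity (pointLaw f) i =
      ((pointLaw f).map fun x => x i).rnDeriv volume := rfl
  rw [h, map_eval_pointLaw hf i]
  exact Measure.rnDeriv_withDensity _ (measurable_sliceMass hf i .univ)

/-- The measure with `sliceMass f i t` as its values. -/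
noncomputable def sliceMeasure {m : ℕ} (f : (Fin (m + 1) → ℝ) → ℝ) (i : Fin (m + 1)) (t : ℝ) :
    Measure (Fin (m + 1) → ℝ) :=
  (volume.withDensity fun z : Fin m → ℝ =>
    ENNReal.ofReal (f (i.insertNth (α := fun _ => ℝ) t z))).map
      fun z => i.insertNth (α := fun _ => ℝ) t z

omit hf in
theorem sliceMeasure_apply (t : ℝ) {A : Set (Fin (m + 1) → ℝ)} (hA : MeasurableSet A) :
    sliceMeasure f i t A = sliceMass f i t A := by
  have hi : Measurable fun z : Fin m → ℝ => i.insertNth (α := fun _ => ℝ) t z :=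
    (measurable_insertNth i).comp measurable_prodMk_left
  rw [sliceMeasure, Measure.map_apply hi hA, withDensity_apply _ (hi hA),
    ← lintegral_indicator (hi hA)]
  rfl

omit hf in
theorem sliceMass_le_univ (t : ℝ) (A : Set (Fin (m + 1) → ℝ)) :
    sliceMass f i t A ≤ sliceMass f i t Set.univ :=
  lintegral_mono fun _ => Set.indicator_le_indicator_of_subset (Set.subset_univ _)
    (fun _ => zero_le) _

/-- The normalized slice measures, as a kernel. -/
noncomputable def sliceKernel {m : ℕ} {f : (Fin (m + 1) → ℝ) → ℝ} (hf : Measurable f)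
    (i : Fin (m + 1)) : Kernel ℝ (Fin (m + 1) → ℝ) where
  toFun t := (sliceMass f i t Set.univ)⁻¹ • sliceMeasure f i t
  measurable' := by
    refine Measure.measurable_of_measurable_coe _ fun A hA => ?_
    simp only [Measure.smul_apply, sliceMeasure_apply i _ hA, smul_eq_mul]
    exact (measurable_sliceMass hf i .univ).inv.mul (measurable_sliceMass hf i hA)

theorem sliceKernel_apply (t : ℝ) {A : Set (Fin (m + 1) → ℝ)} (hA : MeasurableSet A) :
    sliceKernel hf i t A = (sliceMass f i t Set.univ)⁻¹ * sliceMass f i t A := by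
  rw [← sliceMeasure_apply i t hA]
  rfl

/-- The kernel is only sub-Markov: it vanishes where the slice mass is `0` or `∞`. Finiteness
suffices for uniqueness of the conditional law. -/
instance sliceKernel.isFiniteKernel {m : ℕ} {f : (Fin (m + 1) → ℝ) → ℝ} (hf : Measurable f)
    (i : Fin (m + 1)) : IsFiniteKernel (sliceKernel hf i) :=
  ⟨1, ENNReal.one_lt_top, fun t => by
    rw [sliceKernel_apply hf i t .univ]
    exact ENNReal.inv_mul_le_one _⟩

theorem ae_sliceMass_lt_top [IsFiniteMeasure (pointLaw f)] :
    ∀ᵐ t, sliceMass f i t Set.univ < ∞ := by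
  refine ae_lt_top (measurable_sliceMass hf i .univ) ?_
  rw [← setLIntegral_univ, setLIntegral_sliceMass hf i .univ .univ]
  exact measure_ne_top _ _

theorem sliceMass_univ_mul_sliceKernel {t : ℝ} (ht : sliceMass f i t Set.univ < ∞)
    {A : Set (Fin (m + 1) → ℝ)} (hA : MeasurableSet A) :
    sliceMass f i t Set.univ * sliceKernel hf i t A = sliceMass f i t A := by
  rw [sliceKernel_apply hf i t hA]
  by_cases h0 : sliceMass f i t Set.univ = 0
  · have : sliceMass f i t A = 0 := le_antisymm (h0 ▸ sliceMass_le_univ i t A) zero_le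
    rw [this, h0, zero_mul]
  · rw [← mul_assoc, ENNReal.mul_inv_cancel h0 ht.ne, one_mul]

/-- The conditional law given one coordinate, in terms of slices of the density. -/
theorem condProbAt_mul_marginDensity_ae [IsFiniteMeasure (pointLaw f)] :
    ∀ᵐ t, ∀ A, MeasurableSet A →
      condProbAt (pointLaw f) i t A * marginDensity (pointLaw f) i t = sliceMass f i t A := by
  have hmass := measurable_sliceMass hf i .univ
  have hκ : (pointLaw f).map (fun x => (x i, x)) =
      (pointLaw f).map (fun x => x i) ⊗ₘ sliceKernel hf i := by
    refine Measure.ext_prod fun {B A} hB hA => ?_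
    rw [Measure.map_apply (by fun_prop) (hB.prod hA), Measure.compProd_apply_prod hB hA,
      map_eval_pointLaw hf i, setLIntegral_withDensity_eq_setLIntegral_mul _ hmass
        ((sliceKernel hf i).measurable_coe hA) hB]
    have : ∫⁻ t in B, ((fun t => sliceMass f i t Set.univ) * fun t => sliceKernel hf i t A) t =
        ∫⁻ t in B, sliceMass f i t A := by
      refine setLIntegral_congr_fun_ae hB ?_
      filter_upwards [ae_sliceMass_lt_top hf i] with t ht _
      exact sliceMass_univ_mul_sliceKernel hf i ht hA
    rw [this, setLIntegral_sliceMass hf i hB hA]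
    rfl
  have h := condDistrib_ae_eq_of_measure_eq_compProd (μ := pointLaw f)
    (fun x : Fin (m + 1) → ℝ => x i) (Y := fun x => x) (by fun_prop) hκ
  -- The conditional law is unique only almost everywhere for the margin, that is, for almost every
  -- `t` with nonzero slice mass. At the remaining `t` both sides of the claim vanish.
  rw [map_eval_pointLaw hf i, Filter.EventuallyEq, ae_withDensity_iff hmass] at h
  filter_upwards [h, marginDensity_ae hf i, ae_sliceMass_lt_top hf i] with t h1 h2 h3 A hA
  rw [h2]
  by_cases h0 : sliceMass f i t Set.univ = 0
  · have : sliceMass f i t A = 0 := le_antisymm (h0 ▸ sliceMass_le_univ i t A) zero_le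
    rw [this, h0, mul_zero]
  · rw [condProbAt, h1 h0, mul_comm, sliceMass_univ_mul_sliceKernel hf i h3 hA]

end slice

/-! ### Order statistics through counts. -/

section orderStat

variable {n : ℕ} {A : Set (Fin n)} {v : Fin n → ℝ} {r : ℕ}

theorem ncard_le_eq_add (A : Set (Fin n)) (v : Fin n → ℝ) (t : ℝ) :
    {k | k ∈ A ∧ v k ≤ t}.ncard = {k | k ∈ A ∧ v k < t}.ncard + {k | k ∈ A ∧ v k = t}.ncard := by
  rw [← Set.ncard_union_eq]
  · congr 1
    ext k
    simp only [Set.mem_ofPred_eq, Set.mem_union, le_iff_lt_or_eq, and_or_left]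
  · rw [Set.disjoint_left]
    rintro k ⟨-, h⟩ ⟨-, h'⟩
    exact h.ne h'

theorem ncard_eq_le_add (A : Set (Fin n)) (v : Fin n → ℝ) (t : ℝ) :
    A.ncard = {k | k ∈ A ∧ v k ≤ t}.ncard + {k | k ∈ A ∧ t < v k}.ncard := by
  rw [← Set.ncard_union_eq]
  · congr 1
    ext k
    simp only [Set.mem_ofPred_eq, Set.mem_union, ← and_or_left]
    exact ⟨fun h => ⟨h, le_or_gt _ _⟩, And.left⟩
  · rw [Set.disjoint_left]
    rintro k ⟨-, h⟩ ⟨-, h'⟩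
    exact h.not_gt h'

/-- Any `s < t` has at most `r - 1` values `≤ s`, so `t` is the least element of the defining set.
-/
theorem orderStat_eq {t : ℝ} (hr : 1 ≤ r) (hlt : {k | k ∈ A ∧ v k < t}.ncard = r - 1)
    (heq : {k | k ∈ A ∧ v k = t}.ncard = 1) : orderStat A v r = t := by
  refine IsLeast.csInf_eq ⟨?_, fun s hs => ?_⟩
  · rw [Set.mem_ofPred_eq, ncard_le_eq_add, hlt, heq]
    omega
  · by_contra! hst
    have : {k | k ∈ A ∧ v k ≤ s}.ncard ≤ {k | k ∈ A ∧ v k < t}.ncard :=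
      Set.ncard_le_ncard fun k hk => ⟨hk.1, hk.2.trans_lt hst⟩
    have hs' : r ≤ {k | k ∈ A ∧ v k ≤ s}.ncard := hs
    omega

/-- Without ties, the number of smaller values is an injective rank from `A` into `{0, …, |A| - 1}`,
hence a surjective one. The element of rank `r - 1` realizes the order statistic. -/
theorem orderStat_spec (hv : Function.Injective v) (hr : 1 ≤ r) (hrA : r ≤ A.ncard) :
    {k | k ∈ A ∧ v k < orderStat A v r}.ncard = r - 1 ∧
    {k | k ∈ A ∧ v k = orderStat A v r}.ncard = 1 ∧
    {k | k ∈ A ∧ orderStat A v r < v k}.ncard = A.ncard - r := by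
  obtain ⟨k, hk, hkr⟩ : ∃ k ∈ A, {j | j ∈ A ∧ v j < v k}.ncard = r - 1 := by
    have hrank : ∀ i j, i ∈ A → v i < v j →
        {k | k ∈ A ∧ v k < v i}.ncard < {k | k ∈ A ∧ v k < v j}.ncard := fun i j hi hij =>
      Set.ncard_lt_ncard ⟨fun k hk => ⟨hk.1, hk.2.trans hij⟩,
        fun h => (h (show i ∈ _ from ⟨hi, hij⟩)).2.false⟩
    have hs := Set.surj_on_of_inj_on_of_ncard_le (s := A)
      (t := (Finset.range A.ncard : Set ℕ)) (fun k _ => {j | j ∈ A ∧ v j < v k}.ncard)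
      (fun k hk => by
        rw [Finset.coe_range, Set.mem_Iio]
        exact Set.ncard_lt_ncard ⟨fun j hj => hj.1, fun h => (h hk).2.false⟩)
      (fun i j hi hj hij => by
        rcases lt_trichotomy (v i) (v j) with h | h | h
        · exact absurd hij (hrank i j hi h).ne
        · exact hv h
        · exact absurd hij (hrank j i hj h).ne')
      (by rw [Set.ncard_coe_finset, Finset.card_range]) (Finset.finite_toSet _)
    obtain ⟨k, hk, h⟩ := hs (r - 1) (by
      rw [Finset.coe_range, Set.mem_Iio]
      omega)
    exact ⟨k, hk, h.symm⟩
  have hone : {j | j ∈ A ∧ v j = v k}.ncard = 1 := by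
    rw [Set.ncard_eq_one]
    refine ⟨k, Set.ext fun j => ⟨fun h => hv h.2, ?_⟩⟩
    rintro rfl
    exact ⟨hk, rfl⟩
  have ht := orderStat_eq hr hkr hone
  rw [ht]
  refine ⟨hkr, hone, ?_⟩
  have h1 := ncard_eq_le_add A v (v k)
  have h2 := ncard_le_eq_add A v (v k)
  omega

end orderStat

/-! ### The partition of space by end points and cells. -/

/-- The end points of the segmentation, lower ones on the left. -/
abbrev EndPoint (m : ℕ) : Type := Fin (m + 1) ⊕ Fin (m + 1)

/-- The cells of a segmentation: the middle cell is `none`; on either side there is one cell for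
each coordinate but the first, and a final one. -/
abbrev SegCell (m : ℕ) : Type := Option (Option (Fin m) ⊕ Option (Fin m))

namespace EndPoint

variable {m : ℕ}

/-- The coordinate that an end point belongs to. -/
def coord (p : EndPoint m) : Fin (m + 1) := Sum.elim id id p

/-- The points that take part in the order statistic defining an end point. -/
def stage (c : EndPoint m → ℝ) : EndPoint m → Set (Fin (m + 1) → ℝ)
  | .inl i => {x | ∀ j < i, x j < c (.inl j)}
  | .inr i => {x | ∀ j < i, c (.inr j) < x j}

end EndPoint

open EndPoint

/-- The part of space that belongs to an end point or a cell. -/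
def segRegion {m : ℕ} (c : EndPoint m → ℝ) : EndPoint m ⊕ SegCell m → Set (Fin (m + 1) → ℝ)
  | .inl p => {x | x ∈ stage c p ∧ x p.coord = c p}
  | .inr none => {x | c (.inl 0) < x 0 ∧ x 0 < c (.inr 0)}
  | .inr (some (.inl (some k))) =>
      {x | (∀ j < k.succ, x j < c (.inl j)) ∧ c (.inl k.succ) < x k.succ}
  | .inr (some (.inl none)) => {x | ∀ j, x j < c (.inl j)}
  | .inr (some (.inr (some k))) =>
      {x | (∀ j < k.succ, c (.inr j) < x j) ∧ x k.succ < c (.inr k.succ)}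
  | .inr (some (.inr none)) => {x | ∀ j, c (.inr j) < x j}

/-- The number of sample points in each part. -/
def segCount {m : ℕ} (n : ℕ) (l u : Fin (m + 1) → ℕ) : EndPoint m ⊕ SegCell m → ℕ
  | .inl _ => 1
  | .inr none => u 0 - l 0 - 1
  | .inr (some (.inl (some k))) => l k.castSucc - l k.succ - 1
  | .inr (some (.inl none)) => l (Fin.last m) - 1
  | .inr (some (.inr (some k))) => u k.succ - 1
  | .inr (some (.inr none)) => n - ∑ i, u i

/-- The first coordinate decides between middle, lower and upper side. On a side, the region is
determined by the first coordinate that fails the strict inequality, and by whether it fails with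
equality. The hypothesis `hc` keeps the two sides apart. -/
theorem existsUnique_segRegion {m : ℕ} {c : EndPoint m → ℝ} (hc : c (.inl 0) < c (.inr 0))
    (x : Fin (m + 1) → ℝ) : ∃! s, x ∈ segRegion c s := by
  refine existsUnique_of_exists_of_unique ?_ ?_
  · have hmin : ∀ p : Fin (m + 1) → Prop, (¬ ∀ i, p i) → ∃ i, ¬ p i ∧ ∀ j < i, p j := by
      intro p hp
      push Not at hp
      obtain ⟨i, hi, hmin⟩ := wellFounded_lt.has_min {i | ¬ p i} hp
      exact ⟨i, hi, fun j hj => by_contra fun h => hmin j h hj⟩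
    rcases lt_trichotomy (x 0) (c (.inl 0)) with h | h | h
    · by_cases hall : ∀ j, x j < c (.inl j)
      · exact ⟨.inr (some (.inl none)), hall⟩
      obtain ⟨i, hi, hlt⟩ := hmin _ hall
      rcases (not_lt.mp hi).eq_or_lt with hi | hi
      · exact ⟨.inl (.inl i), hlt, hi.symm⟩
      · rcases i.eq_zero_or_eq_succ with rfl | ⟨k, rfl⟩
        · exact absurd h hi.not_gt
        · exact ⟨.inr (some (.inl (some k))), hlt, hi⟩
    · exact ⟨.inl (.inl 0), fun j hj => absurd hj (Fin.not_lt_zero j), h⟩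
    · rcases lt_trichotomy (x 0) (c (.inr 0)) with h' | h' | h'
      · exact ⟨.inr none, h, h'⟩
      · exact ⟨.inl (.inr 0), fun j hj => absurd hj (Fin.not_lt_zero j), h'⟩
      · by_cases hall : ∀ j, c (.inr j) < x j
        · exact ⟨.inr (some (.inr none)), hall⟩
        obtain ⟨i, hi, hlt⟩ := hmin _ hall
        rcases (not_lt.mp hi).eq_or_lt with hi | hi
        · exact ⟨.inl (.inr i), hlt, hi⟩
        · rcases i.eq_zero_or_eq_succ with rfl | ⟨k, rfl⟩
          · exact absurd h' hi.not_gt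
          · exact ⟨.inr (some (.inr (some k))), hlt, hi⟩
  · have hz : ∀ k : Fin m, (0 : Fin (m + 1)) < k.succ := fun k => k.succ_pos
    have hz' : ∀ i : Fin (m + 1), i = 0 ∨ 0 < i := by grind
    have hs : ∀ i j : Fin m, i = j ∨ i.succ < j.succ ∨ j.succ < i.succ := by grind
    have ht : ∀ i j : Fin (m + 1), i = j ∨ i < j ∨ j < i := by grind
    rintro ((i | i) | (_ | ((_ | i) | (_ | i)))) ((j | j) | (_ | ((_ | j) | (_ | j)))) h h' <;>
      simp only [segRegion, stage, coord, Set.mem_ofPred_eq, Sum.elim_inl, Sum.elim_inr, id] at h h'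
        <;> grind

/-! ### Assignments and the symbol on their events. -/

/-- The assignments of sample points to end points and cells with the prescribed numbers. -/
abbrev SegAssignment {m : ℕ} (n : ℕ) (l u : Fin (m + 1) → ℕ) : Type :=
  {σ : Fin n → EndPoint m ⊕ SegCell m // ∀ s, {k | σ k = s}.ncard = segCount n l u s}

namespace SegAssignment

variable {m n : ℕ} {l u : Fin (m + 1) → ℕ}

theorem exists_index (σ : SegAssignment n l u) :
    ∃ e : EndPoint m → Fin n, ∀ p k, σ.1 k = .inl p ↔ k = e p := by
  have h : ∀ p, ∃ a, {k | σ.1 k = .inl p} = {a} := fun p =>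
    Set.ncard_eq_one.mp (σ.2 (.inl p))
  choose e he using h
  exact ⟨e, fun p k => Set.ext_iff.mp (he p) k⟩

/-- The sample point that is assigned to an end point. -/
noncomputable def index (σ : SegAssignment n l u) : EndPoint m → Fin n := σ.exists_index.choose

theorem eq_inl_iff (σ : SegAssignment n l u) {p : EndPoint m} {k : Fin n} :
    σ.1 k = .inl p ↔ k = σ.index p := σ.exists_index.choose_spec p k

theorem apply_index (σ : SegAssignment n l u) (p : EndPoint m) : σ.1 (σ.index p) = .inl p :=
  σ.eq_inl_iff.mpr rfl

/-- The end points read off from the sample points assigned to them. -/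
noncomputable def endPoints (σ : SegAssignment n l u) (x : Fin n → Fin (m + 1) → ℝ)
    (p : EndPoint m) : ℝ := x (σ.index p) p.coord

/-- The samples that are segmented according to `σ`. -/
def event (σ : SegAssignment n l u) : Set (Fin n → Fin (m + 1) → ℝ) :=
  {x | σ.endPoints x (.inl 0) < σ.endPoints x (.inr 0) ∧
    ∀ k, x k ∈ segRegion (σ.endPoints x) (σ.1 k)}

theorem mem_segRegion_iff (σ : SegAssignment n l u) {x : Fin n → Fin (m + 1) → ℝ}
    (hx : x ∈ σ.event) (k : Fin n) (s : EndPoint m ⊕ SegCell m) :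
    x k ∈ segRegion (σ.endPoints x) s ↔ σ.1 k = s :=
  ⟨fun h => (existsUnique_segRegion hx.1 (x k)).unique (hx.2 k) h, fun h => h ▸ hx.2 k⟩

theorem ncard_mem_segRegion (σ : SegAssignment n l u) {x : Fin n → Fin (m + 1) → ℝ}
    (hx : x ∈ σ.event) (s : EndPoint m ⊕ SegCell m) :
    {k | x k ∈ segRegion (σ.endPoints x) s}.ncard = segCount n l u s := by
  simp only [σ.mem_segRegion_iff hx]
  exact σ.2 s

/-- Counts accumulate outwards from the innermost lower cell, hence the reverse induction. The
points below the end points up to `i` split at the next one into `l (i+1) - 1` below, one on it and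
`l i - l (i+1) - 1` above, in total `l i - 1`. Strict decrease of `l` keeps the truncated
subtraction exact. -/
theorem ncard_lower (σ : SegAssignment n l u) (hl_pos : ∀ i, 1 ≤ l i)
    (hl_anti : ∀ k : Fin m, l k.succ < l k.castSucc)
    {x : Fin n → Fin (m + 1) → ℝ} (hx : x ∈ σ.event) (i : Fin (m + 1)) :
    {k | ∀ j ≤ i, x k j < σ.endPoints x (.inl j)}.ncard = l i - 1 := by
  induction i using Fin.reverseInduction with
  | last =>
    rw [← show segCount n l u (.inr (some (.inl none))) = l (Fin.last m) - 1 from rfl,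
      ← σ.ncard_mem_segRegion hx]
    congr 1
    ext k
    simp [segRegion, Fin.le_last]
  | cast i ih =>
    have h1 := σ.ncard_mem_segRegion hx (.inl (.inl i.succ))
    have h2 := σ.ncard_mem_segRegion hx (.inr (some (.inl (some i))))
    simp only [segRegion, segCount, stage, coord, Set.mem_ofPred_eq, Sum.elim_inl, id] at h1 h2
    set A : Set (Fin n) := {k | ∀ j ≤ i.castSucc, x k j < σ.endPoints x (.inl j)} with hA
    have hA' : ∀ k, k ∈ A ↔ ∀ j < i.succ, x k j < σ.endPoints x (.inl j) := by
      intro k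
      simp [hA, ← Fin.le_castSucc_iff]
    have h3 := ncard_eq_le_add A (fun k => x k i.succ) (σ.endPoints x (.inl i.succ))
    have h4 := ncard_le_eq_add A (fun k => x k i.succ) (σ.endPoints x (.inl i.succ))
    simp only [hA'] at h3 h4
    have h5 : {k | (∀ j < i.succ, x k j < σ.endPoints x (.inl j)) ∧
        x k i.succ < σ.endPoints x (.inl i.succ)} =
        {k | ∀ j ≤ i.succ, x k j < σ.endPoints x (.inl j)} := by
      ext k
      simp only [Set.mem_ofPred_eq, le_iff_lt_or_eq]
      grind
    rw [h5] at h4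
    have := hl_pos i.succ
    have := hl_anti i
    omega

/-- Once the earlier end points agree, both sides see the same stage, and the counts below and on
the end point identify the order statistic. -/
theorem segLower_eq (σ : SegAssignment n l u) (hl_pos : ∀ i, 1 ≤ l i)
    (hl_anti : ∀ k : Fin m, l k.succ < l k.castSucc)
    {x : Fin n → Fin (m + 1) → ℝ} (hx : x ∈ σ.event) (i : Fin (m + 1)) :
    segLower l x i = σ.endPoints x (.inl i) := by
  induction i using WellFoundedLT.induction with
  | ind i ih =>
    rw [segLower]
    have hA : {k | ∀ j, (_h : j < i) → x k j < segLower l x j} =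
        {k | ∀ j < i, x k j < σ.endPoints x (.inl j)} := by
      ext k
      exact forall₂_congr fun j hj => by rw [ih j hj]
    rw [hA]
    refine orderStat_eq (hl_pos i) ?_ (σ.ncard_mem_segRegion hx (.inl (.inl i)))
    rw [← σ.ncard_lower hl_pos hl_anti hx i]
    congr 1
    ext k
    simp only [Set.mem_ofPred_eq, le_iff_lt_or_eq]
    grind

theorem segUpper_eq (σ : SegAssignment n l u) (hl_pos : ∀ i, 1 ≤ l i)
    (hl_anti : ∀ k : Fin m, l k.succ < l k.castSucc) (hu_pos : ∀ i, 1 ≤ u i) (hlu : l 0 < u 0)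
    {x : Fin n → Fin (m + 1) → ℝ} (hx : x ∈ σ.event) (i : Fin (m + 1)) :
    segUpper u x i = σ.endPoints x (.inr i) := by
  induction i using WellFoundedLT.induction with
  | ind i ih =>
    rw [segUpper]
    have hA : {k | ∀ j, (_h : j < i) → segUpper u x j < x k j} =
        {k | ∀ j < i, σ.endPoints x (.inr j) < x k j} := by
      ext k
      exact forall₂_congr fun j hj => by rw [ih j hj]
    rw [hA]
    refine orderStat_eq (hu_pos i) ?_ (σ.ncard_mem_segRegion hx (.inl (.inr i)))
    -- For later coordinates the count `u i - 1` is that of a cell. For the first it is assembled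
    -- across the lower side: `(l 0 - 1) + 1 + (u 0 - l 0 - 1) = u 0 - 1`.
    rcases i.eq_zero_or_eq_succ with rfl | ⟨i, rfl⟩
    · have h1 := σ.ncard_mem_segRegion hx (.inl (.inl 0))
      have h2 := σ.ncard_mem_segRegion hx (.inr none)
      have h3 := σ.ncard_lower hl_pos hl_anti hx 0
      simp only [segRegion, segCount, stage, coord, Set.mem_ofPred_eq, Sum.elim_inl, id,
        Fin.not_lt_zero, false_imp_iff, implies_true, true_and, Fin.le_zero_iff,
        forall_eq] at h1 h2 h3 ⊢
      set a := σ.endPoints x (.inl 0)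
      set b := σ.endPoints x (.inr 0)
      have hab : a < b := hx.1
      set A : Set (Fin n) := {k | x k 0 < b} with hA
      have h4 := ncard_eq_le_add A (fun k => x k 0) a
      have h5 := ncard_le_eq_add A (fun k => x k 0) a
      have e1 : {k | k ∈ A ∧ x k 0 < a} = {k | x k 0 < a} := by
        ext k; simp only [hA, Set.mem_ofPred_eq]; grind
      have e2 : {k | k ∈ A ∧ x k 0 = a} = {k | x k 0 = a} := by
        ext k; simp only [hA, Set.mem_ofPred_eq]; grind
      have e3 : {k | k ∈ A ∧ a < x k 0} = {k | a < x k 0 ∧ x k 0 < b} := by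
        ext k; simp only [hA, Set.mem_ofPred_eq]; grind
      rw [e1, e2] at h5
      rw [e3] at h4
      have := hl_pos 0
      omega
    · exact σ.ncard_mem_segRegion hx (.inr (some (.inr (some i))))

theorem endPoints_eq (σ : SegAssignment n l u) (hl_pos : ∀ i, 1 ≤ l i)
    (hl_anti : ∀ k : Fin m, l k.succ < l k.castSucc) (hu_pos : ∀ i, 1 ≤ u i) (hlu : l 0 < u 0)
    {x : Fin n → Fin (m + 1) → ℝ} (hx : x ∈ σ.event) :
    σ.endPoints x = Sum.elim (segLower l x) (segUpper u x) := by
  funext p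
  rcases p with i | i
  · exact (σ.segLower_eq hl_pos hl_anti hx i).symm
  · exact (σ.segUpper_eq hl_pos hl_anti hu_pos hlu hx i).symm

/-- On either event the end points are those of the sample. They fix the regions, and the region of
each sample point is its assigned value. -/
theorem pairwise_disjoint_event (hl_pos : ∀ i, 1 ≤ l i)
    (hl_anti : ∀ k : Fin m, l k.succ < l k.castSucc) (hu_pos : ∀ i, 1 ≤ u i) (hlu : l 0 < u 0) :
    Pairwise (Function.onFun Disjoint (event : SegAssignment n l u → _)) := by
  intro σ τ hστ
  refine Set.disjoint_left.mpr fun x hσ hτ => hστ (Subtype.ext (funext fun k => ?_))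
  have h := (τ.mem_segRegion_iff hτ k _).mpr rfl
  rw [τ.endPoints_eq hl_pos hl_anti hu_pos hlu hτ,
    ← σ.endPoints_eq hl_pos hl_anti hu_pos hlu hσ] at h
  exact (σ.mem_segRegion_iff hσ k _).mp h

end SegAssignment

/-! ### Samples without ties belong to an event. -/

section TieFree

variable {m n : ℕ} {l u : Fin (m + 1) → ℕ} {x : Fin n → Fin (m + 1) → ℝ}

theorem segLower_spec (hx : ∀ i, Function.Injective fun k => x k i) {i : Fin (m + 1)}
    (hl : 1 ≤ l i) (hi : l i ≤ {k | ∀ j < i, x k j < segLower l x j}.ncard) :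
    {k | (∀ j < i, x k j < segLower l x j) ∧ x k i < segLower l x i}.ncard = l i - 1 ∧
    {k | (∀ j < i, x k j < segLower l x j) ∧ x k i = segLower l x i}.ncard = 1 ∧
    {k | (∀ j < i, x k j < segLower l x j) ∧ segLower l x i < x k i}.ncard =
      {k | ∀ j < i, x k j < segLower l x j}.ncard - l i := by
  have h := orderStat_spec (A := {k | ∀ j < i, x k j < segLower l x j}) (hx i) hl hi
  have e : orderStat {k | ∀ j < i, x k j < segLower l x j} (fun k => x k i) (l i) =
      segLower l x i := by rw [segLower]
  rw [e] at h
  exact h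

theorem segUpper_spec (hx : ∀ i, Function.Injective fun k => x k i) {i : Fin (m + 1)}
    (hu : 1 ≤ u i) (hi : u i ≤ {k | ∀ j < i, segUpper u x j < x k j}.ncard) :
    {k | (∀ j < i, segUpper u x j < x k j) ∧ x k i < segUpper u x i}.ncard = u i - 1 ∧
    {k | (∀ j < i, segUpper u x j < x k j) ∧ x k i = segUpper u x i}.ncard = 1 ∧
    {k | (∀ j < i, segUpper u x j < x k j) ∧ segUpper u x i < x k i}.ncard =
      {k | ∀ j < i, segUpper u x j < x k j}.ncard - u i := by
  have h := orderStat_spec (A := {k | ∀ j < i, segUpper u x j < x k j}) (hx i) hu hi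
  have e : orderStat {k | ∀ j < i, segUpper u x j < x k j} (fun k => x k i) (u i) =
      segUpper u x i := by rw [segUpper]
  rw [e] at h
  exact h

theorem forall_lt_succ_and {m : ℕ} {p : Fin (m + 1) → Prop} (i : Fin m) :
    (∀ j < i.succ, p j) ↔ (∀ j < i.castSucc, p j) ∧ p i.castSucc := by
  simp only [← Fin.le_castSucc_iff, le_iff_lt_or_eq]
  grind

theorem forall_and_last {m : ℕ} {p : Fin (m + 1) → Prop} :
    (∀ j, p j) ↔ (∀ j < Fin.last m, p j) ∧ p (Fin.last m) := by
  have : ∀ j, j < Fin.last m ∨ j = Fin.last m := fun j => (Fin.le_last j).lt_or_eq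
  grind

theorem ncard_stage_lower_succ (hx : ∀ i, Function.Injective fun k => x k i)
    (hl_pos : ∀ i, 1 ≤ l i) {i : Fin m}
    (hi : l i.castSucc ≤ {k | ∀ j < i.castSucc, x k j < segLower l x j}.ncard) :
    {k | ∀ j < i.succ, x k j < segLower l x j}.ncard = l i.castSucc - 1 := by
  simp only [forall_lt_succ_and]
  exact (segLower_spec hx (hl_pos _) hi).1

/-- Each later stage has exactly `l (i-1) - 1` points, which is enough because `l` decreases
strictly. Thus every order statistic taken is meaningful. -/
theorem le_ncard_stage_lower (hx : ∀ i, Function.Injective fun k => x k i)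
    (hl_pos : ∀ i, 1 ≤ l i) (hl_anti : ∀ k : Fin m, l k.succ < l k.castSucc) (hln : l 0 ≤ n)
    (i : Fin (m + 1)) : l i ≤ {k | ∀ j < i, x k j < segLower l x j}.ncard := by
  induction i using Fin.induction with
  | zero => simpa [Set.ncard_univ] using hln
  | succ i ih =>
    rw [ncard_stage_lower_succ hx hl_pos ih]
    have := hl_anti i
    omega

theorem sum_Iio_succ {m : ℕ} (u : Fin (m + 1) → ℕ) (i : Fin m) :
    ∑ j ∈ Finset.Iio i.succ, u j = ∑ j ∈ Finset.Iio i.castSucc, u j + u i.castSucc := by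
  have : Finset.Iio i.succ = insert i.castSucc (Finset.Iio i.castSucc) := by
    ext j
    simp only [Finset.mem_Iio, Finset.mem_insert, ← Fin.le_castSucc_iff, le_iff_lt_or_eq]
    tauto
  rw [this, Finset.sum_insert (by simp), add_comm]

theorem sum_Iio_add_le {m : ℕ} (u : Fin (m + 1) → ℕ) (i : Fin (m + 1)) :
    ∑ j ∈ Finset.Iio i, u j + u i ≤ ∑ j, u j := by
  rw [add_comm, ← Finset.sum_insert (by simp : i ∉ Finset.Iio i)]
  exact Finset.sum_le_sum_of_subset (Finset.subset_univ _)

theorem sum_Iio_last_add {m : ℕ} (u : Fin (m + 1) → ℕ) :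
    ∑ j ∈ Finset.Iio (Fin.last m), u j + u (Fin.last m) = ∑ j, u j := by
  rw [add_comm, ← Finset.sum_insert (by simp : Fin.last m ∉ Finset.Iio (Fin.last m))]
  congr 1
  ext j
  simp only [Finset.mem_insert, Finset.mem_Iio, Finset.mem_univ, iff_true]
  exact (Fin.le_last j).eq_or_lt

/-- Each upper stage discards `u i` points: the `u i - 1` below its end point and the one on it. -/
theorem ncard_stage_upper (hx : ∀ i, Function.Injective fun k => x k i)
    (hu_pos : ∀ i, 1 ≤ u i) (hu_sum : ∑ i, u i ≤ n) (i : Fin (m + 1)) :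
    {k | ∀ j < i, segUpper u x j < x k j}.ncard = n - ∑ j ∈ Finset.Iio i, u j := by
  induction i using Fin.induction with
  | zero =>
    have : Finset.Iio (0 : Fin (m + 1)) = ∅ := by
      ext j
      simp
    simp [Set.ncard_univ, this]
  | succ i ih =>
    have h := sum_Iio_add_le u i.castSucc
    simp only [forall_lt_succ_and]
    rw [(segUpper_spec hx (hu_pos _) (by omega)).2.2, ih, sum_Iio_succ]
    omega

/-- Send each sample point to its unique region relative to the actual end points. What remains is
to check that every region receives the prescribed count. -/
theorem exists_mem_event (hl_pos : ∀ i, 1 ≤ l i)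
    (hl_anti : ∀ k : Fin m, l k.succ < l k.castSucc) (hu_pos : ∀ i, 1 ≤ u i)
    (hu_sum : ∑ i, u i ≤ n) (hlu : l 0 < u 0) (hx : ∀ i, Function.Injective fun k => x k i) :
    ∃ σ : SegAssignment n l u, x ∈ σ.event := by
  have hu0 : u 0 ≤ n :=
    (Finset.single_le_sum (fun _ _ => Nat.zero_le _) (Finset.mem_univ 0)).trans hu_sum
  have hL i := segLower_spec hx (hl_pos i)
    (le_ncard_stage_lower hx hl_pos hl_anti (hlu.le.trans hu0) i)
  have hU' i := ncard_stage_upper hx hu_pos hu_sum i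
  have hU i := segUpper_spec hx (hu_pos i) (by
    have := sum_Iio_add_le u i
    have := hU' i
    omega)
  set c : EndPoint m → ℝ := Sum.elim (segLower l x) (segUpper u x)
  have hL0 := hL 0
  have hU0 := hU 0
  simp only [Fin.not_lt_zero, false_imp_iff, implies_true, true_and, Set.ofPred_true,
    Set.ncard_univ, Nat.card_fin] at hL0 hU0
  -- The reverse inequality would give `u 0 - 1 ≤ l 0 - 1`.
  have hc : c (.inl 0) < c (.inr 0) := by
    by_contra! h
    have : {k | x k 0 < segUpper u x 0}.ncard ≤ {k | x k 0 < segLower l x 0}.ncard :=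
      Set.ncard_le_ncard fun k hk => lt_of_lt_of_le hk h
    have := hl_pos 0
    omega
  choose σ hσ hσu using fun k => existsUnique_segRegion hc (x k)
  have hcount : ∀ s, {k | σ k = s}.ncard = segCount n l u s := by
    intro s
    have : {k | σ k = s} = {k | x k ∈ segRegion c s} := by
      ext k
      exact ⟨fun h => h ▸ hσ k, fun h => (hσu k s h).symm⟩
    rw [this]
    rcases s with (i | i) | (_ | ((_ | i) | (_ | i)))
    · exact (hL i).2.1
    · exact (hU i).2.1
    · simp only [segRegion, segCount, Set.mem_ofPred_eq]
      set a := c (.inl 0)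
      set b := c (.inr 0)
      replace hL0 : {k | x k 0 < a}.ncard = _ ∧ {k | x k 0 = a}.ncard = _ ∧ _ := hL0
      replace hU0 : {k | x k 0 < b}.ncard = _ ∧ {k | x k 0 = b}.ncard = _ ∧ _ := hU0
      set A : Set (Fin n) := {k | x k 0 < b} with hA
      have h4 := ncard_eq_le_add A (fun k => x k 0) a
      have h5 := ncard_le_eq_add A (fun k => x k 0) a
      have e1 : {k | k ∈ A ∧ x k 0 < a} = {k | x k 0 < a} := by
        ext k; simp only [hA, Set.mem_ofPred_eq]; grind
      have e2 : {k | k ∈ A ∧ x k 0 = a} = {k | x k 0 = a} := by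
        ext k; simp only [hA, Set.mem_ofPred_eq]; grind
      have e3 : {k | k ∈ A ∧ a < x k 0} = {k | a < x k 0 ∧ x k 0 < b} := by
        ext k; simp only [hA, Set.mem_ofPred_eq]; grind
      rw [e1, e2] at h5
      rw [e3] at h4
      have := hl_pos 0
      omega
    · refine Eq.trans ?_ (hL (Fin.last m)).1
      congr 1
      ext k
      exact forall_and_last
    · have h := (hL i.succ).2.2
      rw [ncard_stage_lower_succ hx hl_pos
        (le_ncard_stage_lower hx hl_pos hl_anti (hlu.le.trans hu0) _)] at h
      refine Eq.trans h ?_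
      simp only [segCount]
      omega
    · have h := (hU (Fin.last m)).2.2
      rw [hU', Nat.sub_sub, sum_Iio_last_add] at h
      refine Eq.trans ?_ h
      congr 1
      ext k
      exact forall_and_last
    · exact (hU i.succ).1
  let τ : SegAssignment n l u := ⟨σ, hcount⟩
  -- The region of an end point includes the equation saying that its coordinate equals that end
  -- point.
  have hτ : τ.endPoints x = c := by
    funext p
    have h := hσ (τ.index p)
    rw [show σ (τ.index p) = .inl p from τ.apply_index p] at h
    exact h.2
  refine ⟨τ, ?_, ?_⟩
  · rw [hτ]
    exact hc
  · rw [hτ]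
    exact hσ

end TieFree

/-! ### Measurability of the moving regions. -/

theorem measurableSet_forall_lt {β : Type*} [MeasurableSpace β] {ι : Type*} [Countable ι]
    (q : ι → Prop) {f g : ι → β → ℝ} (hf : ∀ i, Measurable (f i)) (hg : ∀ i, Measurable (g i)) :
    MeasurableSet {b | ∀ i, q i → f i b < g i b} := by
  have : {b | ∀ i, q i → f i b < g i b} = ⋂ i, ⋂ _ : q i, {b | f i b < g i b} := by
    ext b
    simp
  rw [this]
  exact .iInter fun i => .iInter fun _ => measurableSet_lt (hf i) (hg i)

section Measurability

variable {m : ℕ}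

theorem measurableSet_stage_prod (p : EndPoint m) :
    MeasurableSet {q : (EndPoint m → ℝ) × (Fin (m + 1) → ℝ) | q.2 ∈ stage q.1 p} := by
  rcases p with i | i
  · exact measurableSet_forall_lt (fun j => j < i) (fun j => by fun_prop) fun j => by fun_prop
  · exact measurableSet_forall_lt (fun j => j < i) (fun j => by fun_prop) fun j => by fun_prop

/-- Joint measurability is needed because in Tonelli the regions depend on end points that are
themselves integrated. -/
theorem measurableSet_segRegion_prod (s : EndPoint m ⊕ SegCell m) :
    MeasurableSet {q : (EndPoint m → ℝ) × (Fin (m + 1) → ℝ) | q.2 ∈ segRegion q.1 s} := by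
  rcases s with p | (_ | ((_ | k) | (_ | k)))
  · exact (measurableSet_stage_prod p).inter
      (measurableSet_eq_fun (f := fun q : (EndPoint m → ℝ) × (Fin (m + 1) → ℝ) => q.2 p.coord)
        (g := fun q => q.1 p) (by fun_prop) (by fun_prop))
  · exact (measurableSet_lt
      (f := fun q : (EndPoint m → ℝ) × (Fin (m + 1) → ℝ) => q.1 (.inl 0))
      (g := fun q => q.2 0) (by fun_prop) (by fun_prop)).inter
      (measurableSet_lt (f := fun q : (EndPoint m → ℝ) × (Fin (m + 1) → ℝ) => q.2 0)
        (g := fun q => q.1 (.inr 0)) (by fun_prop) (by fun_prop))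
  · simpa using! measurableSet_forall_lt (fun _ : Fin (m + 1) => True)
      (f := fun j (q : (EndPoint m → ℝ) × (Fin (m + 1) → ℝ)) => q.2 j)
      (g := fun j q => q.1 (.inl j)) (fun j => by fun_prop) fun j => by fun_prop
  · exact (measurableSet_stage_prod (.inl k.succ)).inter (measurableSet_lt
      (f := fun q : (EndPoint m → ℝ) × (Fin (m + 1) → ℝ) => q.1 (.inl k.succ))
      (g := fun q => q.2 k.succ) (by fun_prop) (by fun_prop))
  · simpa using! measurableSet_forall_lt (fun _ : Fin (m + 1) => True)
      (f := fun j (q : (EndPoint m → ℝ) × (Fin (m + 1) → ℝ)) => q.1 (.inr j))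
      (g := fun j q => q.2 j) (fun j => by fun_prop) fun j => by fun_prop
  · exact (measurableSet_stage_prod (.inr k.succ)).inter (measurableSet_lt
      (f := fun q : (EndPoint m → ℝ) × (Fin (m + 1) → ℝ) => q.2 k.succ)
      (g := fun q => q.1 (.inr k.succ)) (by fun_prop) (by fun_prop))

theorem measurableSet_segRegion (t : EndPoint m → ℝ) (s : EndPoint m ⊕ SegCell m) :
    MeasurableSet (segRegion t s) :=
  measurable_prodMk_left (measurableSet_segRegion_prod s)

theorem measurable_indicator_prod {f : (Fin (m + 1) → ℝ) → ℝ} (hf : Measurable f)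
    {S : (EndPoint m → ℝ) → Set (Fin (m + 1) → ℝ)}
    (hS : MeasurableSet {q : (EndPoint m → ℝ) × (Fin (m + 1) → ℝ) | q.2 ∈ S q.1}) :
    Measurable (Function.uncurry fun t => (S t).indicator fun x => ENNReal.ofReal (f x)) :=
  (hf.ennreal_ofReal.comp measurable_snd).indicator hS

end Measurability

/-! ### The end-point density for one assignment. -/

/-- The density of the end points of a fixed assignment of the sample points. -/
noncomputable def endPointDensity {m : ℕ} (n : ℕ) (l u : Fin (m + 1) → ℕ)
    (f : (Fin (m + 1) → ℝ) → ℝ) : (EndPoint m → ℝ) → ℝ≥0∞ :=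
  {t | t (.inl 0) < t (.inr 0)}.indicator fun t =>
    (∏ c : SegCell m, pointLaw f (segRegion t (.inr c)) ^ segCount n l u (.inr c)) *
      ∏ p : EndPoint m, sliceMass f p.coord (t p) (stage t p)

section Density

variable {m n : ℕ} {l u : Fin (m + 1) → ℕ} {f : (Fin (m + 1) → ℝ) → ℝ}

theorem pointLaw_eq_lintegral_indicator {A : Set (Fin (m + 1) → ℝ)} (hA : MeasurableSet A) :
    pointLaw f A = ∫⁻ x, A.indicator (fun x => ENNReal.ofReal (f x)) x := by
  rw [lintegral_indicator hA, pointLaw, withDensity_apply _ hA]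

theorem measurable_cellFactor (hf : Measurable f) :
    Measurable fun t : EndPoint m → ℝ =>
      ∏ c : SegCell m, pointLaw f (segRegion t (.inr c)) ^ segCount n l u (.inr c) := by
  refine Finset.measurable_prod _ fun c _ => Measurable.pow_const ?_ _
  simp only [pointLaw_eq_lintegral_indicator (measurableSet_segRegion _ _)]
  exact (measurable_indicator_prod hf (S := fun t => segRegion t (.inr c))
    (measurableSet_segRegion_prod (.inr c))).lintegral_prod_right'

theorem measurableSet_endPoint_lt :
    MeasurableSet {t : EndPoint m → ℝ | t (.inl 0) < t (.inr 0)} :=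
  measurableSet_lt (by fun_prop) (by fun_prop)

theorem measurable_endPointDensity (hf : Measurable f) :
    Measurable (endPointDensity n l u f) := by
  refine ((measurable_cellFactor hf).mul (Finset.measurable_prod _ fun p _ => ?_)).indicator
    measurableSet_endPoint_lt
  have : Measurable fun q : (EndPoint m → ℝ) × (Fin m → ℝ) =>
      (stage q.1 p).indicator (fun x => ENNReal.ofReal (f x))
        (p.coord.insertNth (α := fun _ => ℝ) (q.1 p) q.2) :=
    (measurable_indicator_prod hf (S := fun t => stage t p) (measurableSet_stage_prod p)).comp
      (measurable_fst.prodMk ((measurable_insertNth p.coord).comp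
        (((measurable_pi_apply p).comp measurable_fst).prodMk measurable_snd)))
  exact this.lintegral_prod_right'

/-- On the slice the equation for the coordinate of `p` holds automatically. -/
theorem sliceMass_stage (t : EndPoint m → ℝ) (p : EndPoint m) :
    sliceMass f p.coord (t p) (stage t p) =
      sliceMass f p.coord (t p) (segRegion t (.inl p)) := by
  have h : ∀ x : Fin (m + 1) → ℝ, x p.coord = t p →
      (stage t p).indicator (fun x => ENNReal.ofReal (f x)) x =
        (segRegion t (.inl p)).indicator (fun x => ENNReal.ofReal (f x)) x := by
    intro x hx
    by_cases h : x ∈ stage t p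
    · rw [Set.indicator_of_mem h, Set.indicator_of_mem (show x ∈ segRegion t (.inl p) from ⟨h, hx⟩)]
    · rw [Set.indicator_of_notMem h, Set.indicator_of_notMem fun h' => h h'.1]
  exact lintegral_congr fun z => h _ (by simp)

end Density

namespace SegAssignment

variable {m n : ℕ} {l u : Fin (m + 1) → ℕ}

/-- The sample points, split into those that serve as end points and the others. -/
noncomputable def indexEquiv (σ : SegAssignment n l u) :
    EndPoint m ⊕ {k // k ∉ Set.range σ.index} ≃ Fin n :=
  ((Equiv.ofInjective σ.index fun p q h => by
    have := σ.apply_index p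
    rw [h, σ.apply_index q] at this
    exact (Sum.inl_injective this).symm).sumCongr (Equiv.refl _)).trans
      (Equiv.Set.sumCompl (Set.range σ.index))

theorem indexEquiv_inl (σ : SegAssignment n l u) (p : EndPoint m) :
    σ.indexEquiv (.inl p) = σ.index p :=
  Equiv.Set.sumCompl_apply_inl _ _

theorem indexEquiv_inr (σ : SegAssignment n l u) (r : {k // k ∉ Set.range σ.index}) :
    σ.indexEquiv (.inr r) = r :=
  Equiv.Set.sumCompl_apply_inr _ _

theorem prod_rest (σ : SegAssignment n l u) [Fintype {k // k ∉ Set.range σ.index}]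
    (F : EndPoint m ⊕ SegCell m → ℝ≥0∞) :
    ∏ r : {k // k ∉ Set.range σ.index}, F (σ.1 r) =
      ∏ c : SegCell m, F (.inr c) ^ segCount n l u (.inr c) := by
  classical
  -- The value `1` on end points extends the product to all sample points, so that it can be grouped
  -- by the fibres of `σ`, whose sizes are prescribed.
  let F' : EndPoint m ⊕ SegCell m → ℝ≥0∞ := Sum.elim (fun _ => 1) fun c => F (.inr c)
  have h1 : ∏ k, F' (σ.1 k) = ∏ r : {k // k ∉ Set.range σ.index}, F (σ.1 r) := by
    rw [← σ.indexEquiv.prod_comp, Fintype.prod_sum_type (α₁ := EndPoint m)]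
    have : ∏ p, F' (σ.1 (σ.indexEquiv (.inl p))) = 1 :=
      Finset.prod_eq_one fun p _ => by rw [indexEquiv_inl, apply_index]; rfl
    rw [this, one_mul]
    refine Finset.prod_congr rfl fun r _ => ?_
    rw [indexEquiv_inr]
    rcases h : σ.1 r with p | c
    · exact absurd ⟨p, (σ.eq_inl_iff.mp h).symm⟩ r.2
    · rfl
  rw [← h1, ← Finset.prod_fiberwise Finset.univ σ.1]
  have h2 : ∀ s, ∏ k with σ.1 k = s, F' (σ.1 k) = F' s ^ segCount n l u s := by
    intro s
    rw [← σ.2 s, Set.ncard_eq_toFinset_card', Set.toFinset_ofPred, ← Finset.prod_const]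
    exact Finset.prod_congr rfl fun k hk => by rw [(Finset.mem_filter.mp hk).2]
  simp only [h2, Fintype.prod_sum_type]
  simp [F']

theorem measurable_endPoints (σ : SegAssignment n l u) : Measurable σ.endPoints :=
  measurable_pi_iff.mpr fun p =>
    (measurable_pi_apply p.coord).comp (measurable_pi_apply (σ.index p))

theorem measurableSet_event (σ : SegAssignment n l u) : MeasurableSet σ.event := by
  have h : σ.event = σ.endPoints ⁻¹' {t | t (.inl 0) < t (.inr 0)} ∩
      ⋂ k, (fun x => (σ.endPoints x, x k)) ⁻¹' {q | q.2 ∈ segRegion q.1 (σ.1 k)} := by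
    ext x
    simp [event]
  rw [h]
  exact (σ.measurable_endPoints measurableSet_endPoint_lt).inter (.iInter fun k =>
    (σ.measurable_endPoints.prodMk (measurable_pi_apply k)) (measurableSet_segRegion_prod _))

/-- The indicator of the event factors over sample points once the end points are treated as
parameters. The assignment enters only through the fibre sizes, so the right side is the same for
all `σ`. -/
theorem setLIntegral_event (σ : SegAssignment n l u) {f : (Fin (m + 1) → ℝ) → ℝ}
    (hf : Measurable f) {Φ : (EndPoint m → ℝ) → ℝ≥0∞} (hΦ : Measurable Φ) :
    ∫⁻ x in σ.event, Φ (σ.endPoints x) * ∏ k, ENNReal.ofReal (f (x k)) =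
      ∫⁻ t, Φ t * endPointDensity n l u f t := by
  classical
  let h (s : EndPoint m ⊕ SegCell m) (t : EndPoint m → ℝ) : (Fin (m + 1) → ℝ) → ℝ≥0∞ :=
    (segRegion t s).indicator fun x => ENNReal.ofReal (f x)
  have hh : ∀ s, Measurable (Function.uncurry (h s)) := fun s =>
    measurable_indicator_prod hf (S := fun t => segRegion t s) (measurableSet_segRegion_prod s)
  let Ψ : (EndPoint m → ℝ) → ℝ≥0∞ := {t | t (.inl 0) < t (.inr 0)}.indicator Φ
  have hΨ : Measurable Ψ := hΦ.indicator measurableSet_endPoint_lt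
  let κ : (EndPoint m → Fin (m + 1) → ℝ) → EndPoint m → ℝ := fun y p => y p p.coord
  have hκ : Measurable κ := measurable_pi_iff.mpr fun p =>
    (measurable_pi_apply p.coord).comp (measurable_pi_apply p)
  have h1 : ∀ x : Fin n → Fin (m + 1) → ℝ,
      σ.event.indicator (fun x => Φ (σ.endPoints x) * ∏ k, ENNReal.ofReal (f (x k))) x =
        (Ψ (κ fun p => x (σ.indexEquiv (.inl p))) *
          ∏ p, h (.inl p) (κ fun p => x (σ.indexEquiv (.inl p))) (x (σ.indexEquiv (.inl p)))) *
        ∏ r : {k // k ∉ Set.range σ.index}, h (σ.1 r) (κ fun p => x (σ.indexEquiv (.inl p)))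
          (x (σ.indexEquiv (.inr r))) := by
    intro x
    have hκx : (κ fun p => x (σ.indexEquiv (.inl p))) = σ.endPoints x := by
      funext p
      simp only [κ, indexEquiv_inl, endPoints]
    have hprod : (∏ p, h (.inl p) (σ.endPoints x) (x (σ.indexEquiv (.inl p)))) *
        ∏ r : {k // k ∉ Set.range σ.index}, h (σ.1 r) (σ.endPoints x)
          (x (σ.indexEquiv (.inr r))) = ∏ k, h (σ.1 k) (σ.endPoints x) (x k) := by
      rw [← σ.indexEquiv.prod_comp (fun k => h (σ.1 k) (σ.endPoints x) (x k)),
        Fintype.prod_sum_type (α₁ := EndPoint m)]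
      congr 1
      exact Finset.prod_congr rfl fun p _ => by rw [indexEquiv_inl, apply_index]
    rw [hκx, mul_assoc, hprod]
    by_cases hx : x ∈ σ.event
    · rw [Set.indicator_of_mem hx]
      congr 1
      · exact (Set.indicator_of_mem (show σ.endPoints x ∈ _ from hx.1) _).symm
      · exact Finset.prod_congr rfl fun k _ => (Set.indicator_of_mem (hx.2 k)
          fun x => ENNReal.ofReal (f x)).symm
    · rw [Set.indicator_of_notMem hx]
      by_cases h0 : σ.endPoints x (.inl 0) < σ.endPoints x (.inr 0)
      · obtain ⟨k, hk⟩ : ∃ k, x k ∉ segRegion (σ.endPoints x) (σ.1 k) := by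
          by_contra! hall
          exact hx ⟨h0, hall⟩
        rw [Finset.prod_eq_zero (Finset.mem_univ k) (Set.indicator_of_notMem hk _), mul_zero]
      · rw [show Ψ (σ.endPoints x) = 0 from Set.indicator_of_notMem
          (show σ.endPoints x ∉ {t : EndPoint m → ℝ | t (.inl 0) < t (.inr 0)} from h0) Φ, zero_mul]
  rw [← lintegral_indicator σ.measurableSet_event, lintegral_congr h1]
  have hφ : Measurable fun y : EndPoint m → Fin (m + 1) → ℝ =>
      Ψ (κ y) * ∏ p, h (.inl p) (κ y) (y p) := by
    refine (hΨ.comp hκ).mul (Finset.measurable_prod _ fun p _ => ?_)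
    exact (hh _).comp (hκ.prodMk (measurable_pi_apply p))
  -- Integrates out the points in the cells; each contributes the probability of its cell.
  rw [lintegral_prod_sum_reindex σ.indexEquiv
    (fun y => Ψ (κ y) * ∏ p, h (.inl p) (κ y) (y p)) hφ
    (fun r y => h (σ.1 r) (κ y)) fun r =>
      (hh (σ.1 r)).comp ((hκ.comp measurable_fst).prodMk measurable_snd)]
  have h2 : ∀ y : EndPoint m → Fin (m + 1) → ℝ,
      (Ψ (κ y) * ∏ p, h (.inl p) (κ y) (y p)) *
        ∏ r : {k // k ∉ Set.range σ.index}, ∫⁻ z, h (σ.1 r) (κ y) z =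
      (fun t => Ψ t * ∏ c : SegCell m,
        pointLaw f (segRegion t (.inr c)) ^ segCount n l u (.inr c)) (fun p => y p p.coord) *
        ∏ p, h (.inl p) (fun p => y p p.coord) (y p) := by
    intro y
    rw [mul_right_comm]
    congr 2
    simp only [h, ← pointLaw_eq_lintegral_indicator (measurableSet_segRegion _ _)]
    exact σ.prod_rest fun s => pointLaw f (segRegion (κ y) s)
  -- Keeps the end-point coordinate of each remaining point and integrates its other coordinates to
  -- a slice mass.
  rw [lintegral_congr h2, lintegral_pi_insertNth coord
    (fun t => Ψ t * ∏ c : SegCell m, pointLaw f (segRegion t (.inr c)) ^ segCount n l u (.inr c))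
    (hΨ.mul (measurable_cellFactor hf))
    (fun p => h (.inl p)) fun p => hh _]
  refine lintegral_congr fun t => ?_
  have h3 : ∀ p, ∫⁻ z : Fin m → ℝ, h (.inl p) t (p.coord.insertNth (α := fun _ => ℝ) (t p) z) =
      sliceMass f p.coord (t p) (stage t p) := fun p => (sliceMass_stage t p).symm
  simp only [h3, endPointDensity, Ψ]
  by_cases ht : t (.inl 0) < t (.inr 0)
  · rw [Set.indicator_of_mem (show t ∈ {t | t (.inl 0) < t (.inr 0)} from ht),
      Set.indicator_of_mem (show t ∈ {t | t (.inl 0) < t (.inr 0)} from ht), mul_assoc]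
  · rw [Set.indicator_of_notMem (show t ∉ {t | t (.inl 0) < t (.inr 0)} from ht),
      Set.indicator_of_notMem (show t ∉ {t | t (.inl 0) < t (.inr 0)} from ht)]
    simp

end SegAssignment

/-! ### The law of the symbol. -/

section Law

variable {m n : ℕ} {l u : Fin (m + 1) → ℕ}

/-- A tie is the kernel of a nonzero linear functional, a proper subspace and hence null. -/
theorem volume_coord_eq (k k' : Fin n) (hk : k ≠ k') (i : Fin (m + 1)) :
    volume {x : Fin n → Fin (m + 1) → ℝ | x k i = x k' i} = 0 := by
  let L : (Fin n → Fin (m + 1) → ℝ) →ₗ[ℝ] ℝ :=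
    { toFun x := x k i - x k' i
      map_add' x y := by simp only [Pi.add_apply]; ring
      map_smul' c x := by simp only [Pi.smul_apply, smul_eq_mul, RingHom.id_apply]; ring }
  have hL : LinearMap.ker L ≠ ⊤ := by
    intro h
    have hx : (Pi.single k (fun _ => 1) : Fin n → Fin (m + 1) → ℝ) ∈ LinearMap.ker L :=
      h ▸ Submodule.mem_top
    simp [L, hk.symm] at hx
  have : {x : Fin n → Fin (m + 1) → ℝ | x k i = x k' i} = LinearMap.ker L := by
    ext x
    simp [L, sub_eq_zero]
  rw [this]
  exact Measure.addHaar_submodule volume _ hL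

theorem ae_injective_coord :
    ∀ᵐ x : Fin n → Fin (m + 1) → ℝ, ∀ i, Function.Injective fun k => x k i := by
  have h : ∀ᵐ x : Fin n → Fin (m + 1) → ℝ, ∀ (k k' : Fin n) (i : Fin (m + 1)),
      k ≠ k' → x k i ≠ x k' i := by
    simp only [ae_all_iff]
    intro k k' i hk
    rw [ae_iff]
    simpa using volume_coord_eq k k' hk i
  filter_upwards [h] with x hx i k k' hkk'
  by_contra hne
  exact hx k k' i hne hkk'

theorem ae_mem_iUnion_event (hl_pos : ∀ i, 1 ≤ l i)
    (hl_anti : ∀ k : Fin m, l k.succ < l k.castSucc) (hu_pos : ∀ i, 1 ≤ u i)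
    (hu_sum : ∑ i, u i ≤ n) (hlu : l 0 < u 0) :
    ∀ᵐ x : Fin n → Fin (m + 1) → ℝ, x ∈ ⋃ σ : SegAssignment n l u, σ.event := by
  filter_upwards [ae_injective_coord] with x hx
  exact Set.mem_iUnion.mpr (exists_mem_event hl_pos hl_anti hu_pos hu_sum hlu hx)

/-- A sample of distinct integer points on the diagonal has no ties, so it yields an assignment.
This gives `C > 0`. -/
theorem nonempty_segAssignment (hl_pos : ∀ i, 1 ≤ l i)
    (hl_anti : ∀ k : Fin m, l k.succ < l k.castSucc) (hu_pos : ∀ i, 1 ≤ u i)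
    (hu_sum : ∑ i, u i ≤ n) (hlu : l 0 < u 0) : Nonempty (SegAssignment n l u) := by
  obtain ⟨σ, -⟩ := exists_mem_event (x := fun k _ => (k : ℕ)) hl_pos hl_anti hu_pos hu_sum hlu
    fun _ k k' h => Fin.ext (Nat.cast_injective h)
  exact ⟨σ⟩

/-- The symbol with given end points. -/
def symbolOfEndPoints {m : ℕ} (n : ℕ) (t : EndPoint m → ℝ) : RectSymbol (m + 1) :=
  (fun i => t (.inl i), fun i => t (.inr i), n)

theorem measurable_symbolOfEndPoints :
    Measurable (symbolOfEndPoints n : (EndPoint m → ℝ) → RectSymbol (m + 1)) := by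
  unfold symbolOfEndPoints
  fun_prop

theorem SegAssignment.iterSeg_eq (σ : SegAssignment n l u) (hl_pos : ∀ i, 1 ≤ l i)
    (hl_anti : ∀ k : Fin m, l k.succ < l k.castSucc) (hu_pos : ∀ i, 1 ≤ u i) (hlu : l 0 < u 0)
    {x : Fin n → Fin (m + 1) → ℝ} (hx : x ∈ σ.event) :
    iterSeg l u x = symbolOfEndPoints n (σ.endPoints x) := by
  rw [σ.endPoints_eq hl_pos hl_anti hu_pos hlu hx]
  rfl

/-- On each of the finitely many events the symbol is a fixed selection of coordinates, and the
events cover almost everything. -/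
theorem aemeasurable_iterSeg (hl_pos : ∀ i, 1 ≤ l i)
    (hl_anti : ∀ k : Fin m, l k.succ < l k.castSucc) (hu_pos : ∀ i, 1 ≤ u i)
    (hu_sum : ∑ i, u i ≤ n) (hlu : l 0 < u 0) :
    AEMeasurable (iterSeg l u : (Fin n → Fin (m + 1) → ℝ) → _) volume := by
  rw [← Measure.restrict_eq_self_of_ae_mem
    (ae_mem_iUnion_event hl_pos hl_anti hu_pos hu_sum hlu), aemeasurable_iUnion_iff]
  intro σ
  refine ((measurable_symbolOfEndPoints (n := n)).comp σ.measurable_endPoints).aemeasurable.congr ?_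
  filter_upwards [ae_restrict_mem σ.measurableSet_event] with x hx
  exact (σ.iterSeg_eq hl_pos hl_anti hu_pos hlu hx).symm

/-- Summing over the disjoint events repeats the same integral, so the number of assignments comes
out as the constant. -/
theorem lintegral_iterSeg (hl_pos : ∀ i, 1 ≤ l i)
    (hl_anti : ∀ k : Fin m, l k.succ < l k.castSucc) (hu_pos : ∀ i, 1 ≤ u i)
    (hu_sum : ∑ i, u i ≤ n) (hlu : l 0 < u 0) {f : (Fin (m + 1) → ℝ) → ℝ} (hf : Measurable f)
    {Φ : RectSymbol (m + 1) → ℝ≥0∞} (hΦ : Measurable Φ) :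
    ∫⁻ x : Fin n → Fin (m + 1) → ℝ, Φ (iterSeg l u x) * ∏ k, ENNReal.ofReal (f (x k)) =
      Nat.card (SegAssignment n l u) *
        ∫⁻ t, Φ (symbolOfEndPoints n t) * endPointDensity n l u f t := by
  have := Fintype.ofFinite (SegAssignment n l u)
  rw [← Measure.restrict_eq_self_of_ae_mem
    (ae_mem_iUnion_event hl_pos hl_anti hu_pos hu_sum hlu),
    lintegral_iUnion (fun σ => σ.measurableSet_event)
      (SegAssignment.pairwise_disjoint_event hl_pos hl_anti hu_pos hlu), tsum_fintype]
  have h : ∀ σ : SegAssignment n l u,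
      ∫⁻ x in σ.event, Φ (iterSeg l u x) * ∏ k, ENNReal.ofReal (f (x k)) =
        ∫⁻ t, Φ (symbolOfEndPoints n t) * endPointDensity n l u f t := by
    intro σ
    refine Eq.trans ?_ (σ.setLIntegral_event hf (hΦ.comp (measurable_symbolOfEndPoints (n := n))))
    refine setLIntegral_congr_fun σ.measurableSet_event fun x hx => ?_
    rw [σ.iterSeg_eq hl_pos hl_anti hu_pos hlu hx]
  simp only [h, Finset.sum_const, nsmul_eq_mul, Nat.card_eq_fintype_card, Finset.card_univ]

/-- The density of the end points, as a function of the symbol. -/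
noncomputable def symbolDensity {m : ℕ} (n : ℕ) (l u : Fin (m + 1) → ℕ)
    (f : (Fin (m + 1) → ℝ) → ℝ) : RectSymbol (m + 1) → ℝ≥0∞ :=
  {s | s.2.2 = n}.indicator fun s => endPointDensity n l u f (Sum.elim s.1 s.2.1)

theorem measurable_symbolDensity {f : (Fin (m + 1) → ℝ) → ℝ} (hf : Measurable f) :
    Measurable (symbolDensity n l u f) := by
  refine ((measurable_endPointDensity hf).comp ?_).indicator ?_
  · refine measurable_pi_iff.mpr ?_
    rintro (i | i)
    · exact (measurable_pi_apply i).comp measurable_fst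
    · exact (measurable_pi_apply i).comp (measurable_fst.comp measurable_snd)
  · exact (measurable_snd.comp measurable_snd) (measurableSet_singleton n)

theorem lintegral_symbolMeasure {F : RectSymbol (m + 1) → ℝ≥0∞} (hF : Measurable F)
    (h0 : ∀ s, s.2.2 ≠ n → F s = 0) :
    ∫⁻ s, F s ∂symbolMeasure (m + 1) = ∫⁻ t : EndPoint m → ℝ, F (symbolOfEndPoints n t) := by
  have hp := volume_measurePreserving_sumPiEquivProdPi_symm fun _ : EndPoint m => ℝ
  have hF' : Measurable fun t : EndPoint m → ℝ => F (symbolOfEndPoints n t) :=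
    hF.comp measurable_symbolOfEndPoints
  have hFp : Measurable fun z : (Fin (m + 1) → ℝ) × (Fin (m + 1) → ℝ) => F (symbolOfEndPoints n
      ((MeasurableEquiv.sumPiEquivProdPi fun _ : EndPoint m => ℝ).symm z)) :=
    hF'.comp hp.measurable
  rw [← hp.lintegral_comp hF', Measure.volume_eq_prod,
    lintegral_prod _ hFp.aemeasurable, symbolMeasure, lintegral_prod _ hF.aemeasurable]
  refine lintegral_congr fun a => ?_
  have hFa : Measurable fun y : (Fin (m + 1) → ℝ) × ℕ => F (a, y) :=
    hF.comp measurable_prodMk_left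
  rw [lintegral_prod _ hFa.aemeasurable]
  refine lintegral_congr fun b => ?_
  rw [lintegral_count, tsum_eq_single n fun N hN => h0 _ hN]
  rfl

theorem map_iterSeg (hl_pos : ∀ i, 1 ≤ l i)
    (hl_anti : ∀ k : Fin m, l k.succ < l k.castSucc) (hu_pos : ∀ i, 1 ≤ u i)
    (hu_sum : ∑ i, u i ≤ n) (hlu : l 0 < u 0) {f : (Fin (m + 1) → ℝ) → ℝ} (hf : Measurable f)
    (hf0 : ∀ x, 0 ≤ f x) :
    (volume.withDensity fun x : Fin n → Fin (m + 1) → ℝ =>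
        ENNReal.ofReal (∏ k, f (x k))).map (iterSeg l u) =
      (symbolMeasure (m + 1)).withDensity fun s =>
        Nat.card (SegAssignment n l u) * symbolDensity n l u f s := by
  have hT := aemeasurable_iterSeg hl_pos hl_anti hu_pos hu_sum hlu
  have hG : Measurable fun x : Fin n → Fin (m + 1) → ℝ => ENNReal.ofReal (∏ k, f (x k)) :=
    (Finset.measurable_prod _ fun k _ => hf.comp (measurable_pi_apply k)).ennreal_ofReal
  have hT' := hT.mono_ac (withDensity_absolutelyContinuous volume
    fun x : Fin n → Fin (m + 1) → ℝ => ENNReal.ofReal (∏ k, f (x k)))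
  ext B hB
  have hΦ : Measurable (B.indicator (1 : RectSymbol (m + 1) → ℝ≥0∞)) :=
    measurable_one.indicator hB
  have hΦT : AEMeasurable (fun x : Fin n → Fin (m + 1) → ℝ =>
      B.indicator (1 : RectSymbol (m + 1) → ℝ≥0∞) (iterSeg l u x)) volume :=
    hΦ.comp_aemeasurable hT
  have hΦS : Measurable fun t : EndPoint m → ℝ =>
      B.indicator (1 : RectSymbol (m + 1) → ℝ≥0∞) (symbolOfEndPoints n t) :=
    hΦ.comp measurable_symbolOfEndPoints
  have hΦD : Measurable fun t : EndPoint m → ℝ =>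
      B.indicator (1 : RectSymbol (m + 1) → ℝ≥0∞) (symbolOfEndPoints n t) *
        endPointDensity n l u f t := hΦS.mul (measurable_endPointDensity hf)
  rw [← lintegral_indicator_one hB, lintegral_map' hΦ.aemeasurable hT',
    lintegral_withDensity_eq_lintegral_mul₀ hG.aemeasurable hΦT,
    withDensity_apply _ hB, ← lintegral_indicator hB]
  have h1 : ∀ x : Fin n → Fin (m + 1) → ℝ,
      ((fun x => ENNReal.ofReal (∏ k, f (x k))) *
        fun x => B.indicator (1 : RectSymbol (m + 1) → ℝ≥0∞) (iterSeg l u x) :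
          (Fin n → Fin (m + 1) → ℝ) → ℝ≥0∞) x =
      B.indicator (1 : RectSymbol (m + 1) → ℝ≥0∞) (iterSeg l u x) *
        ∏ k, ENNReal.ofReal (f (x k)) := by
    intro x
    rw [Pi.mul_apply, mul_comm, ENNReal.ofReal_prod_of_nonneg fun k _ => hf0 _]
  rw [lintegral_congr h1, lintegral_iterSeg hl_pos hl_anti hu_pos hu_sum hlu hf hΦ,
    lintegral_symbolMeasure (n := n)
      (((measurable_symbolDensity hf).const_mul _).indicator hB) ?_,
    ← lintegral_const_mul _ hΦD]
  · refine lintegral_congr fun t => ?_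
    have ht : symbolDensity n l u f (symbolOfEndPoints n t) = endPointDensity n l u f t := by
      rw [symbolDensity, Set.indicator_of_mem
        (show symbolOfEndPoints n t ∈ {s : RectSymbol (m + 1) | s.2.2 = n} from rfl)]
      congr 1
      funext p
      cases p <;> rfl
    by_cases hB' : symbolOfEndPoints n t ∈ B
    · simp [hB', ht]
    · simp [hB']
  · intro s hs
    have h : symbolDensity n l u f s = 0 := by
      rw [symbolDensity, Set.indicator_of_notMem
        (show s ∉ {s : RectSymbol (m + 1) | s.2.2 = n} from hs)]
    exact Set.indicator_apply_eq_zero.mpr fun _ => by rw [h, mul_zero]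

end Law

/-! ### From the end-point density to the product formula. -/

section Product

variable {m n : ℕ} {l u : Fin (m + 1) → ℕ} {f : (Fin (m + 1) → ℝ) → ℝ}

theorem pointLaw_hyperplane (i : Fin (m + 1)) (t : ℝ) : pointLaw f {x | x i = t} = 0 := by
  refine withDensity_absolutelyContinuous _ _ ?_
  rw [volume_pi]
  exact Measure.pi_hyperplane (α := fun _ => ℝ) _ i t

/-- The difference of the nested events is the open cell together with part of the null hyperplane
`x i = a i`. -/
theorem pointLaw_lower_cell [IsFiniteMeasure (pointLaw f)] (a : Fin (m + 1) → ℝ)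
    (i : Fin (m + 1)) :
    pointLaw f {x | ∀ j < i, x j < a j} - pointLaw f {x | ∀ j ≤ i, x j < a j} =
      pointLaw f {x | (∀ j < i, x j < a j) ∧ a i < x i} := by
  have hsub : {x : Fin (m + 1) → ℝ | ∀ j ≤ i, x j < a j} ⊆ {x | ∀ j < i, x j < a j} :=
    fun x hx j hj => hx j hj.le
  have hm : MeasurableSet {x : Fin (m + 1) → ℝ | ∀ j ≤ i, x j < a j} :=
    measurableSet_forall_lt (fun j => j ≤ i) (fun j => by fun_prop) fun j => by fun_prop
  rw [← measure_sdiff hsub hm.nullMeasurableSet (measure_ne_top _ _)]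
  refine measure_congr ?_
  have hne : ∀ᵐ x ∂pointLaw f, x i ≠ a i := by
    rw [ae_iff]
    simpa using pointLaw_hyperplane i (a i)
  filter_upwards [hne] with x hx
  refine propext ?_
  have : ∀ j, j ≤ i ↔ j < i ∨ j = i := fun j => le_iff_lt_or_eq
  change ((∀ j < i, x j < a j) ∧ ¬ ∀ j ≤ i, x j < a j) ↔ ((∀ j < i, x j < a j) ∧ a i < x i)
  grind

theorem pointLaw_upper_cell [IsFiniteMeasure (pointLaw f)] (b : Fin (m + 1) → ℝ)
    (i : Fin (m + 1)) :
    pointLaw f {x | ∀ j < i, b j < x j} - pointLaw f {x | ∀ j ≤ i, b j < x j} =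
      pointLaw f {x | (∀ j < i, b j < x j) ∧ x i < b i} := by
  have hsub : {x : Fin (m + 1) → ℝ | ∀ j ≤ i, b j < x j} ⊆ {x | ∀ j < i, b j < x j} :=
    fun x hx j hj => hx j hj.le
  have hm : MeasurableSet {x : Fin (m + 1) → ℝ | ∀ j ≤ i, b j < x j} :=
    measurableSet_forall_lt (fun j => j ≤ i) (fun j => by fun_prop) fun j => by fun_prop
  rw [← measure_sdiff hsub hm.nullMeasurableSet (measure_ne_top _ _)]
  refine measure_congr ?_
  have hne : ∀ᵐ x ∂pointLaw f, x i ≠ b i := by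
    rw [ae_iff]
    simpa using pointLaw_hyperplane i (b i)
  filter_upwards [hne] with x hx
  refine propext ?_
  change ((∀ j < i, b j < x j) ∧ ¬ ∀ j ≤ i, b j < x j) ↔ ((∀ j < i, b j < x j) ∧ x i < b i)
  have : ∀ j, j ≤ i ↔ j < i ∨ j = i := fun j => le_iff_lt_or_eq
  grind

theorem endPointDensity_eq_product [IsFiniteMeasure (pointLaw f)] {s : RectSymbol (m + 1)}
    (hs : s.1 0 < s.2.1 0 ∧ s.2.2 = n)
    (ha : ∀ i A, MeasurableSet A → condProbAt (pointLaw f) i (s.1 i) A *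
      marginDensity (pointLaw f) i (s.1 i) = sliceMass f i (s.1 i) A)
    (hb : ∀ i A, MeasurableSet A → condProbAt (pointLaw f) i (s.2.1 i) A *
      marginDensity (pointLaw f) i (s.2.1 i) = sliceMass f i (s.2.1 i) A)
    (ha0 : marginDensity (pointLaw f) 0 (s.1 0) = sliceMass f 0 (s.1 0) Set.univ)
    (hb0 : marginDensity (pointLaw f) 0 (s.2.1 0) = sliceMass f 0 (s.2.1 0) Set.univ) :
    endPointDensity n l u f (Sum.elim s.1 s.2.1) = iterSegProduct (pointLaw f) l u s := by
  obtain ⟨a, b, N⟩ := s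
  obtain ⟨hab, rfl⟩ := hs
  dsimp only at *
  have hA : ∀ k : Fin m, segP (pointLaw f) l a k =
      sliceMass f k.succ (a k.succ) (stage (Sum.elim a b) (.inl k.succ)) *
        pointLaw f (segRegion (Sum.elim a b) (.inr (some (.inl (some k))))) ^
          (l k.castSucc - l k.succ - 1) := by
    intro k
    rw [segP, pointLaw_lower_cell, ha _ _ (measurableSet_forall_lt (fun j => j < k.succ)
      (fun j => by fun_prop) fun j => by fun_prop)]
    rfl
  have hB : ∀ k : Fin m, segQ (pointLaw f) u b k =
      sliceMass f k.succ (b k.succ) (stage (Sum.elim a b) (.inr k.succ)) *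
        pointLaw f (segRegion (Sum.elim a b) (.inr (some (.inr (some k))))) ^
          (u k.succ - 1) := by
    intro k
    rw [segQ, pointLaw_upper_cell, hb _ _ (measurableSet_forall_lt (fun j => j < k.succ)
      (fun j => by fun_prop) fun j => by fun_prop)]
    rfl
  -- No coordinate precedes the first, so its slice mass is the plain marginal density.
  have ha' : stage (Sum.elim a b) (.inl 0) = Set.univ := by
    ext x
    simp [stage]
  have hb' : stage (Sum.elim a b) (.inr 0) = Set.univ := by
    ext x
    simp [stage]
  rw [endPointDensity, Set.indicator_of_mem
    (show Sum.elim a b ∈ {t : EndPoint m → ℝ | t (.inl 0) < t (.inr 0)} from hab)]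
  simp only [iterSegProduct, hA, hB, ha0, hb0, segPLast, segQLast, Finset.prod_mul_distrib,
    Fintype.prod_option, Fintype.prod_sum_type, Fin.prod_univ_succ, coord, Sum.elim_inl,
    Sum.elim_inr, id, ha', hb', segCount]
  simp only [segRegion, Sum.elim_inl, Sum.elim_inr]
  ring

theorem symbolDensity_ae (hf : Measurable f) [IsFiniteMeasure (pointLaw f)] :
    symbolDensity n l u f =ᵐ[symbolMeasure (m + 1)]
      Set.indicator {s | s.1 0 < s.2.1 0 ∧ s.2.2 = n} (iterSegProduct (pointLaw f) l u) := by
  have hQ : ∀ i, ∀ᵐ t, (∀ A, MeasurableSet A → condProbAt (pointLaw f) i t A *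
      marginDensity (pointLaw f) i t = sliceMass f i t A) ∧
      marginDensity (pointLaw f) i t = sliceMass f i t Set.univ := fun i =>
    (condProbAt_mul_marginDensity_ae hf i).and (marginDensity_ae hf i)
  -- The slice identities fail only on null sets of the line. Evaluation at one end point is
  -- quasi-measure-preserving, so these pull back to null sets of symbols.
  have h1 := ae_all_iff.mpr fun i : Fin (m + 1) =>
    ((Measure.quasiMeasurePreserving_eval (fun _ : Fin (m + 1) => (volume : Measure ℝ)) i).comp
      (Measure.quasiMeasurePreserving_fst (ν := (volume : Measure (Fin (m + 1) → ℝ)).prod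
        (Measure.count : Measure ℕ)))).ae (hQ i)
  have h2 := ae_all_iff.mpr fun i : Fin (m + 1) =>
    ((Measure.quasiMeasurePreserving_eval (fun _ : Fin (m + 1) => (volume : Measure ℝ)) i).comp
      ((Measure.quasiMeasurePreserving_fst (ν := (Measure.count : Measure ℕ))).comp
        (Measure.quasiMeasurePreserving_snd
          (μ := (volume : Measure (Fin (m + 1) → ℝ)))))).ae (hQ i)
  filter_upwards [h1, h2] with s hs1 hs2
  by_cases hs : s.1 0 < s.2.1 0 ∧ s.2.2 = n
  · rw [symbolDensity, Set.indicator_of_mem (show s ∈ {s | s.2.2 = n} from hs.2),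
      Set.indicator_of_mem (show s ∈ {s | s.1 0 < s.2.1 0 ∧ s.2.2 = n} from hs)]
    exact endPointDensity_eq_product hs (fun i => (hs1 i).1) (fun i => (hs2 i).1) (hs1 0).2
      (hs2 0).2
  · rw [Set.indicator_of_notMem (show s ∉ {s | s.1 0 < s.2.1 0 ∧ s.2.2 = n} from hs),
      symbolDensity]
    by_cases hn : s.2.2 = n
    · rw [Set.indicator_of_mem (show s ∈ {s | s.2.2 = n} from hn), endPointDensity,
        Set.indicator_of_notMem (show Sum.elim s.1 s.2.1 ∉ {t : EndPoint m → ℝ |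
          t (.inl 0) < t (.inr 0)} from fun h => hs ⟨h, hn⟩)]
    · rw [Set.indicator_of_notMem (show s ∉ {s | s.2.2 = n} from hn)]

end Product

theorem lemma4 {m n : ℕ} (l u : Fin (m + 1) → ℕ)
    (hl_pos : ∀ i, 1 ≤ l i) (hl_anti : ∀ k : Fin m, l k.succ < l k.castSucc)
    (hu_pos : ∀ i, 1 ≤ u i) (hu_sum : ∑ i, u i ≤ n) (hlu : l 0 < u 0) :
    ∃ C : ℝ≥0, 0 < C ∧
      ∀ {Θ : Type*} {Ω : Type*} [MeasurableSpace Ω]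
        (g : Θ → (Fin (m + 1) → ℝ) → ℝ) (_hg_meas : ∀ θ, Measurable (g θ))
        (_hg_nonneg : ∀ θ x, 0 ≤ g θ x) [∀ θ, IsProbabilityMeasure (pointLaw (g θ))]
        (P : Θ → Measure Ω) [∀ θ, IsProbabilityMeasure (P θ)]
        (X : Fin n → Ω → Fin (m + 1) → ℝ) (_hX_meas : ∀ k, Measurable (X k))
        (_hX : ∀ θ, (P θ).map (fun ω k => X k ω) =
          volume.withDensity fun x : Fin n → Fin (m + 1) → ℝ =>
            ENNReal.ofReal (∏ k, g θ (x k)))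
        (θ : Θ),
        HasPDF (fun ω => iterSeg l u (fun k => X k ω)) (P θ) (symbolMeasure (m + 1)) ∧
        pdf (fun ω => iterSeg l u (fun k => X k ω)) (P θ) (symbolMeasure (m + 1))
          =ᵐ[symbolMeasure (m + 1)]
            Set.indicator {s | s.1 0 < s.2.1 0 ∧ s.2.2 = n}
              (fun s => (C : ℝ≥0∞) * iterSegProduct (pointLaw (g θ)) l u s) := by
  have := nonempty_segAssignment hl_pos hl_anti hu_pos hu_sum hlu
  -- The constant is chosen before the model and the sample, so it depends only on `m`, `n`, `l` and
  -- `u`.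
  refine ⟨Nat.card (SegAssignment n l u), Nat.cast_pos.mpr Nat.card_pos, ?_⟩
  intro Θ Ω _ g hg hg0 _ P _ X hX hXlaw θ
  have hXm : Measurable fun ω k => X k ω := measurable_pi_iff.mpr hX
  have hT : AEMeasurable (iterSeg l u) ((P θ).map fun ω k => X k ω) := by
    rw [hXlaw θ]
    exact (aemeasurable_iterSeg hl_pos hl_anti hu_pos hu_sum hlu).mono_ac
      (withDensity_absolutelyContinuous _ _)
  have hS : AEMeasurable (fun ω => iterSeg l u fun k => X k ω) (P θ) := hT.comp_measurable hXm
  have hD : Measurable fun s =>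
      (Nat.card (SegAssignment n l u) : ℝ≥0∞) * symbolDensity n l u (g θ) s :=
    (measurable_symbolDensity (hg θ)).const_mul _
  have hmap : (P θ).map (fun ω => iterSeg l u fun k => X k ω) =
      (symbolMeasure (m + 1)).withDensity fun s =>
        (Nat.card (SegAssignment n l u) : ℝ≥0∞) * symbolDensity n l u (g θ) s := by
    rw [← map_iterSeg hl_pos hl_anti hu_pos hu_sum hlu (hg θ) (hg0 θ), ← hXlaw θ,
      AEMeasurable.map_map_of_aemeasurable hT hXm.aemeasurable]
    rfl
  have hpdf := hasPDF_of_map_eq_withDensity hS _ hD.aemeasurable hmap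
  refine ⟨hpdf, ((pdf.eq_of_map_eq_withDensity _ hD.aemeasurable).mp hmap).trans ?_⟩
  filter_upwards [symbolDensity_ae (n := n) (l := l) (u := u) (hg θ)] with s hs
  rw [hs, Set.indicator_apply, Set.indicator_apply]
  simp
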